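/- Let $n\ge 0$ and let $T^{2n}=\mathbb R^{2n}/\mathbb Z^{2n}$ be the standard torus of dimension $2n$, with coordinates $x^1,\dots,x^{2n}$. Let $\omega$ be a symplectic form on $T^{2n}$, that is, a smooth closed non-degenerate $2$-form. Then: 1. There is a closed $2$-form $\omega_0=\sum_{i<j}c_{ij}\,dx^i\wedge dx^j$ with constant coefficients $c_{ij}\in\mathbb R$ such that $[\omega]=[\omega_0]$ in $H^2_{dR}(T^{2n})$ and $\omega_0$ is a Kähler form: it is symplectic, and there is a smooth almost complex structure $J$ on $T^{2n}$ ($J^2=-\mathrm{id}$) which is integrable (around every point there are local $J$-holomorphic coordinates with values in $\mathbb C^n$) and $\omega_0$-compatible, i.e. $\omega_0(Ju,Jv)=\omega_0(u,v)$ for all tangent vectors $u,v$ at a point and $\omega_0(w,Jw)>0$ for every non-zero tangent vector $w$. 2. $\omega$ satisfies the Hard Lefschetz Condition: for every $k\in\{0,1,\dots,n\}$ the map $$L^k:H^{n-k}_{dR}(T^{2n})\to H^{n+k}_{dR}(T^{2n}),\qquad [\alpha]\mapsto[\alpha\wedge\omega^k],$$ is an isomorphism (in particular surjective). -/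

import Mathlib

noncomputable section

namespace TorusHLC

/-! ### The wedge product of alternating forms -/

section Wedge

variable {V : Type*} [NormedAddCommGroup V] [NormedSpace ℝ V] {k l : ℕ}

/-- The tensor product of two alternating forms, as a multilinear form:
`(v₁, …, v_{k+l}) ↦ a (v₁, …, v_k) * b (v_{k+1}, …, v_{k+l})`. -/
def tensor (a : V [⋀^Fin k]→L[ℝ] ℝ) (b : V [⋀^Fin l]→L[ℝ] ℝ) :
    ContinuousMultilinearMap ℝ (fun _ : Fin (k + l) => V) ℝ where
  toFun v := a (fun i => v (Fin.castAdd l i)) * b (fun j => v (Fin.natAdd k j))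
  map_update_add' {inst} v i x y := by
    obtain rfl : inst = instDecidableEqFin (k + l) := Subsingleton.elim _ _
    refine Fin.addCases (fun i => ?_) (fun i => ?_) i
    · have h1 : ∀ x : V, (fun j => Function.update v (Fin.castAdd l i) x (Fin.castAdd l j))
          = Function.update (fun j => v (Fin.castAdd l j)) i x := fun x =>
        Function.update_comp_eq_of_injective v (Fin.castAdd_injective k l) i x
      have h2 : ∀ x : V, (fun j => Function.update v (Fin.castAdd l i) x (Fin.natAdd k j))
          = (fun j => v (Fin.natAdd k j)) := fun x => by
        funext j
        rw [Function.update_of_ne]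
        simp [Fin.ext_iff]; omega
      simp only [h1, h2, ContinuousAlternatingMap.map_update_add, add_mul]
    · have h1 : ∀ x : V, (fun j => Function.update v (Fin.natAdd k i) x (Fin.natAdd k j))
          = Function.update (fun j => v (Fin.natAdd k j)) i x := fun x =>
        Function.update_comp_eq_of_injective v (Fin.natAdd_injective l k) i x
      have h2 : ∀ x : V, (fun j => Function.update v (Fin.natAdd k i) x (Fin.castAdd l j))
          = (fun j => v (Fin.castAdd l j)) := fun x => by
        funext j
        rw [Function.update_of_ne]
        simp [Fin.ext_iff]; omega
      simp only [h1, h2, ContinuousAlternatingMap.map_update_add, mul_add]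
  map_update_smul' {inst} v i c x := by
    obtain rfl : inst = instDecidableEqFin (k + l) := Subsingleton.elim _ _
    refine Fin.addCases (fun i => ?_) (fun i => ?_) i
    · have h1 : ∀ x : V, (fun j => Function.update v (Fin.castAdd l i) x (Fin.castAdd l j))
          = Function.update (fun j => v (Fin.castAdd l j)) i x := fun x =>
        Function.update_comp_eq_of_injective v (Fin.castAdd_injective k l) i x
      have h2 : ∀ x : V, (fun j => Function.update v (Fin.castAdd l i) x (Fin.natAdd k j))
          = (fun j => v (Fin.natAdd k j)) := fun x => by
        funext j
        rw [Function.update_of_ne]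
        simp [Fin.ext_iff]; omega
      simp only [h1, h2, ContinuousAlternatingMap.map_update_smul, smul_eq_mul, mul_assoc]
    · have h1 : ∀ x : V, (fun j => Function.update v (Fin.natAdd k i) x (Fin.natAdd k j))
          = Function.update (fun j => v (Fin.natAdd k j)) i x := fun x =>
        Function.update_comp_eq_of_injective v (Fin.natAdd_injective l k) i x
      have h2 : ∀ x : V, (fun j => Function.update v (Fin.natAdd k i) x (Fin.castAdd l j))
          = (fun j => v (Fin.castAdd l j)) := fun x => by
        funext j
        rw [Function.update_of_ne]
        simp [Fin.ext_iff]; omega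
      simp only [h1, h2, ContinuousAlternatingMap.map_update_smul, smul_eq_mul]
      ring
  cont := by
    refine Continuous.mul (a.cont.comp (by fun_prop)) (b.cont.comp (by fun_prop))

/-- The wedge product of alternating forms, with the usual normalization
`(a ∧ b)(v) = (1 / (k! l!)) ∑_σ sign σ • a (v_{σ 1}, …, v_{σ k}) b (v_{σ (k+1)}, …, v_{σ (k+l)})`,
for which `dx¹ ∧ ⋯ ∧ dxᵏ` takes the value `1` on `(e₁, …, e_k)`. -/
def wedge (a : V [⋀^Fin k]→L[ℝ] ℝ) (b : V [⋀^Fin l]→L[ℝ] ℝ) : V [⋀^Fin (k + l)]→L[ℝ] ℝ :=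
  ((k.factorial : ℝ) * l.factorial)⁻¹ • ContinuousMultilinearMap.alternatization (tensor a b)

theorem wedge_apply (a : V [⋀^Fin k]→L[ℝ] ℝ) (b : V [⋀^Fin l]→L[ℝ] ℝ) (v : Fin (k + l) → V) :
    wedge a b v = ((k.factorial : ℝ) * l.factorial)⁻¹ * ∑ σ : Equiv.Perm (Fin (k + l)),
      ((Equiv.Perm.sign σ : ℤ) : ℝ) * (a (fun i => v (σ (Fin.castAdd l i))) *
        b (fun j => v (σ (Fin.natAdd k j)))) := by
  simp only [wedge, ContinuousAlternatingMap.smul_apply, smul_eq_mul,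
    ContinuousMultilinearMap.alternatization_apply_apply]
  congr 1
  refine Finset.sum_congr rfl fun σ _ => ?_
  rw [Units.smul_def, zsmul_eq_mul]
  rfl

/-- The wedge product as a continuous bilinear map. -/
def wedgeL : (V [⋀^Fin k]→L[ℝ] ℝ) →L[ℝ] (V [⋀^Fin l]→L[ℝ] ℝ) →L[ℝ] (V [⋀^Fin (k + l)]→L[ℝ] ℝ) :=
  LinearMap.mkContinuous₂
    (LinearMap.mk₂ ℝ (wedge (V := V) (k := k) (l := l))
      (fun a a' b => by
        ext v
        simp only [wedge_apply, ContinuousAlternatingMap.add_apply, add_mul, mul_add,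
          Finset.sum_add_distrib])
      (fun c a b => by
        ext v
        simp only [wedge_apply, ContinuousAlternatingMap.smul_apply, smul_eq_mul, Finset.mul_sum]
        exact Finset.sum_congr rfl fun σ _ => by ring)
      (fun a b b' => by
        ext v
        simp only [wedge_apply, ContinuousAlternatingMap.add_apply, mul_add,
          Finset.sum_add_distrib])
      (fun c a b => by
        ext v
        simp only [wedge_apply, ContinuousAlternatingMap.smul_apply, smul_eq_mul, Finset.mul_sum]
        exact Finset.sum_congr rfl fun σ _ => by ring))
    (((k.factorial : ℝ) * l.factorial)⁻¹ * (Fintype.card (Equiv.Perm (Fin (k + l))) : ℝ))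
    (fun a b => by
      change ‖wedge a b‖ ≤ _
      refine ContinuousAlternatingMap.opNorm_le_bound (wedge a b) (by positivity) fun v => ?_
      rw [wedge_apply, norm_mul,
        Real.norm_of_nonneg (show 0 ≤ ((k.factorial : ℝ) * l.factorial)⁻¹ by positivity)]
      have hs : ∀ σ : Equiv.Perm (Fin (k + l)), ‖((Equiv.Perm.sign σ : ℤ) : ℝ)‖ = 1 := fun σ => by
        rcases Int.units_eq_one_or (Equiv.Perm.sign σ) with h | h <;> simp [h]
      have hp : ∀ σ : Equiv.Perm (Fin (k + l)), ∏ i, ‖v i‖ =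
          (∏ i, ‖v (σ (Fin.castAdd l i))‖) * ∏ j, ‖v (σ (Fin.natAdd k j))‖ := fun σ => by
        rw [← Equiv.prod_comp σ, Fin.prod_univ_add]
      have hsum : ‖∑ σ : Equiv.Perm (Fin (k + l)), ((Equiv.Perm.sign σ : ℤ) : ℝ) *
          (a (fun i => v (σ (Fin.castAdd l i))) * b (fun j => v (σ (Fin.natAdd k j))))‖ ≤
          (Fintype.card (Equiv.Perm (Fin (k + l))) : ℝ) * (‖a‖ * ‖b‖ * ∏ i, ‖v i‖) := by
        rw [← nsmul_eq_mul, ← Finset.card_univ]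
        refine (norm_sum_le _ _).trans (Finset.sum_le_card_nsmul _ _ _ fun σ _ => ?_)
        rw [norm_mul, hs, one_mul, norm_mul]
        calc _ ≤ (‖a‖ * ∏ i, ‖v (σ (Fin.castAdd l i))‖) *
              (‖b‖ * ∏ j, ‖v (σ (Fin.natAdd k j))‖) :=
              mul_le_mul (a.le_opNorm _) (b.le_opNorm _) (norm_nonneg _) (by positivity)
          _ = _ := by rw [hp σ]; ring
      refine (mul_le_mul_of_nonneg_left hsum (by positivity)).trans (le_of_eq ?_)
      ring)

theorem wedgeL_apply (a : V [⋀^Fin k]→L[ℝ] ℝ) (b : V [⋀^Fin l]→L[ℝ] ℝ) :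
    wedgeL a b = wedge a b := rfl

theorem contDiff_wedge {W : Type*} [NormedAddCommGroup W] [NormedSpace ℝ W] {n : WithTop ℕ∞}
    {f : W → V [⋀^Fin k]→L[ℝ] ℝ} {g : W → V [⋀^Fin l]→L[ℝ] ℝ} (hf : ContDiff ℝ n f)
    (hg : ContDiff ℝ n g) : ContDiff ℝ n (fun x => wedge (f x) (g x)) := by
  have key : ∀ B : (V [⋀^Fin k]→L[ℝ] ℝ) →L[ℝ] (V [⋀^Fin l]→L[ℝ] ℝ) →L[ℝ]
      (V [⋀^Fin (k + l)]→L[ℝ] ℝ), ContDiff ℝ n (fun x => B (f x) (g x)) := fun B =>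
    B.isBoundedBilinearMap.contDiff.comp (hf.prodMk hg)
  simpa only [wedgeL_apply] using key wedgeL

/-- Every permutation of `Fin (n + 1)` is determined by the image of `0` and a permutation
of `Fin n`. -/
theorem sum_perm_succ {n : ℕ} (F : Equiv.Perm (Fin (n + 1)) → ℝ) :
    ∑ τ, F τ = ∑ i : Fin (n + 1), ∑ σ : Equiv.Perm (Fin n),
      F (i.cycleRange.symm * Equiv.Perm.decomposeFin.symm (0, σ)) := by
  refine Eq.trans ?_ (Fintype.sum_prod_type' (fun (i : Fin (n + 1)) (σ : Equiv.Perm (Fin n)) =>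
    F (i.cycleRange.symm * Equiv.Perm.decomposeFin.symm (0, σ))))
  symm
  refine Function.Bijective.sum_comp (e := fun x : Fin (n + 1) × Equiv.Perm (Fin n) =>
    x.1.cycleRange.symm * Equiv.Perm.decomposeFin.symm (0, x.2)) ?_ F
  rw [Fintype.bijective_iff_injective_and_card]
  constructor
  · rintro ⟨i, σ⟩ ⟨j, τ⟩ h
    have h0 : i = j := by
      have := congrArg (fun e : Equiv.Perm (Fin (n + 1)) => e 0) h
      simpa [Equiv.Perm.mul_apply] using this
    subst h0
    have := mul_left_cancel h
    simpa using this
  · simp [Fintype.card_perm, Nat.factorial_succ]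

theorem sum_sign_perm_succ {W : Type*} {n : ℕ} (v : Fin (n + 1) → W) (g : W → (Fin n → W) → ℝ) :
    ∑ i : Fin (n + 1), (-1 : ℝ) ^ (i : ℕ) * ∑ σ : Equiv.Perm (Fin n),
        ((Equiv.Perm.sign σ : ℤ) : ℝ) * g (v i) (fun j => i.removeNth v (σ j)) =
      ∑ τ : Equiv.Perm (Fin (n + 1)), ((Equiv.Perm.sign τ : ℤ) : ℝ) *
        g (v (τ 0)) (fun j => v (τ j.succ)) := by
  rw [sum_perm_succ]
  refine Finset.sum_congr rfl fun i _ => ?_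
  rw [Finset.mul_sum]
  refine Finset.sum_congr rfl fun σ _ => ?_
  simp [Equiv.Perm.mul_apply, Fin.removeNth, mul_assoc]

theorem sum_sign_left {W : Type*} {k l : ℕ} (G : (Fin (k + 1) → W) → (Fin l → W) → ℝ)
    (v : Fin (k + 1 + l) → W) (p : Equiv.Perm (Fin (k + 1))) :
    ∑ σ : Equiv.Perm (Fin (k + 1 + l)), ((Equiv.Perm.sign σ : ℤ) : ℝ) *
      (((Equiv.Perm.sign p : ℤ) : ℝ) * G (fun i => v (σ (Fin.castAdd l (p i))))
        (fun j => v (σ (Fin.natAdd (k + 1) j)))) =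
    ∑ σ : Equiv.Perm (Fin (k + 1 + l)), ((Equiv.Perm.sign σ : ℤ) : ℝ) *
      G (fun i => v (σ (Fin.castAdd l i))) (fun j => v (σ (Fin.natAdd (k + 1) j))) := by
  symm
  let c : Equiv.Perm (Fin (k + 1 + l)) :=
    finSumFinEquiv.permCongr (Equiv.Perm.sumCongr p 1)
  have hc : Equiv.Perm.sign c = Equiv.Perm.sign p := by
    simp [c, Equiv.Perm.sign_permCongr, Equiv.Perm.sign_sumCongr]
  rw [← Equiv.sum_comp (Equiv.mulRight c)]
  refine Finset.sum_congr rfl fun σ _ => ?_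
  have h1 : ∀ i, c (Fin.castAdd l i) = Fin.castAdd l (p i) := fun i => by
    simp [c, Equiv.permCongr_apply]
  have h2 : ∀ j, c (Fin.natAdd (k + 1) j) = Fin.natAdd (k + 1) j := fun i => by
    simp [c, Equiv.permCongr_apply]
  simp only [Equiv.coe_mulRight, Equiv.Perm.mul_apply, h1, h2, Equiv.Perm.sign_mul, hc]
  push_cast
  ring

theorem sum_sign_right {W : Type*} {k l : ℕ} (G : (Fin k → W) → (Fin (l + 1) → W) → ℝ)
    (v : Fin (k + (l + 1)) → W) (p : Equiv.Perm (Fin (l + 1))) :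
    ∑ σ : Equiv.Perm (Fin (k + (l + 1))), ((Equiv.Perm.sign σ : ℤ) : ℝ) *
      (((Equiv.Perm.sign p : ℤ) : ℝ) * G (fun i => v (σ (Fin.castAdd (l + 1) i)))
        (fun j => v (σ (Fin.natAdd k (p j))))) =
    ∑ σ : Equiv.Perm (Fin (k + (l + 1))), ((Equiv.Perm.sign σ : ℤ) : ℝ) *
      G (fun i => v (σ (Fin.castAdd (l + 1) i))) (fun j => v (σ (Fin.natAdd k j))) := by
  symm
  let c : Equiv.Perm (Fin (k + (l + 1))) :=
    finSumFinEquiv.permCongr (Equiv.Perm.sumCongr 1 p)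
  have hc : Equiv.Perm.sign c = Equiv.Perm.sign p := by
    simp [c, Equiv.Perm.sign_permCongr, Equiv.Perm.sign_sumCongr]
  rw [← Equiv.sum_comp (Equiv.mulRight c)]
  refine Finset.sum_congr rfl fun σ _ => ?_
  have h1 : ∀ i, c (Fin.castAdd (l + 1) i) = Fin.castAdd (l + 1) i := fun i => by
    simp [c, Equiv.permCongr_apply]
  have h2 : ∀ j, c (Fin.natAdd k j) = Fin.natAdd k (p j) := fun i => by
    simp [c, Equiv.permCongr_apply]
  simp only [Equiv.coe_mulRight, Equiv.Perm.mul_apply, h1, h2, Equiv.Perm.sign_mul, hc]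
  push_cast
  ring

open ContinuousAlternatingMap in
/-- The algebraic half of the Leibniz rule, derivative on the left factor. -/
theorem alternatizeUncurryFin_wedge_left (A : V →L[ℝ] V [⋀^Fin k]→L[ℝ] ℝ)
    (b : V [⋀^Fin l]→L[ℝ] ℝ) (v : Fin (k + l + 1) → V) :
    alternatizeUncurryFin (wedgeL.flip b ∘L A) v =
      wedge (alternatizeUncurryFin A) b (fun i => v (Fin.cast (by omega) i)) := by
  have hl : alternatizeUncurryFin (wedgeL.flip b ∘L A) v =
      ((k.factorial : ℝ) * l.factorial)⁻¹ * ∑ τ : Equiv.Perm (Fin (k + l + 1)),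
        ((Equiv.Perm.sign τ : ℤ) : ℝ) * (A (v (τ 0)) (fun i => v (τ (Fin.castAdd l i).succ)) *
          b (fun j => v (τ (Fin.natAdd k j).succ))) := by
    rw [← sum_sign_perm_succ v (fun x w => A x (fun i => w (Fin.castAdd l i)) *
      b (fun j => w (Fin.natAdd k j))), alternatizeUncurryFin_apply, Finset.mul_sum]
    refine Finset.sum_congr rfl fun i _ => ?_
    simp only [ContinuousLinearMap.comp_apply, ContinuousLinearMap.flip_apply, wedgeL_apply,
      wedge_apply, zsmul_eq_mul]
    push_cast
    ring
  rw [hl, wedge_apply]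
  simp only [alternatizeUncurryFin_apply, zsmul_eq_mul, Finset.sum_mul, Finset.mul_sum]
  rw [Finset.sum_comm]
  have hr : ∀ i : Fin (k + 1), ∑ σ : Equiv.Perm (Fin (k + 1 + l)),
      (((k + 1).factorial : ℝ) * l.factorial)⁻¹ * (((Equiv.Perm.sign σ : ℤ) : ℝ) *
        (((((-1 : ℤ) ^ (i : ℕ) : ℤ) : ℝ) *
          A (v (Fin.cast (by omega) (σ (Fin.castAdd l i))))
            (i.removeNth fun i => v (Fin.cast (by omega) (σ (Fin.castAdd l i))))) *
          b (fun j => v (Fin.cast (by omega) (σ (Fin.natAdd (k + 1) j)))))) =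
      ∑ σ : Equiv.Perm (Fin (k + 1 + l)),
      (((k + 1).factorial : ℝ) * l.factorial)⁻¹ * (((Equiv.Perm.sign σ : ℤ) : ℝ) *
        (A (v (Fin.cast (by omega) (σ (Fin.castAdd l 0))))
            (fun i => v (Fin.cast (by omega) (σ (Fin.castAdd l i.succ)))) *
          b (fun j => v (Fin.cast (by omega) (σ (Fin.natAdd (k + 1) j)))))) := by
    intro i
    rw [← Finset.mul_sum, ← Finset.mul_sum]
    congr 1
    rw [← sum_sign_left (fun x y => A (x 0) (fun i => x i.succ) * b y)
      (fun i => v (Fin.cast (by omega) i)) i.cycleRange.symm]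
    refine Finset.sum_congr rfl fun σ _ => ?_
    simp +unfoldPartialApp only [Fin.cycleRange_symm_zero, Fin.cycleRange_symm_succ,
      Equiv.Perm.sign_symm, Fin.sign_cycleRange, Fin.removeNth]
    push_cast
    ring
  rw [Finset.sum_congr rfl fun i _ => hr i, Finset.sum_const, Finset.card_univ, Fintype.card_fin,
    nsmul_eq_mul, Finset.mul_sum,
    ← Equiv.sum_comp (finCongr (show k + 1 + l = k + l + 1 by omega)).permCongr]
  refine Finset.sum_congr rfl fun σ _ => ?_
  rw [Equiv.Perm.sign_permCongr, Nat.factorial_succ]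
  have e0 : (finCongr (show k + 1 + l = k + l + 1 by omega)).symm 0 = Fin.castAdd l 0 := by
    ext; simp
  have e1 : ∀ i : Fin k, (finCongr (show k + 1 + l = k + l + 1 by omega)).symm
      (Fin.castAdd l i).succ = Fin.castAdd l i.succ := fun i => by
    ext; simp
  have e2 : ∀ i : Fin l, (finCongr (show k + 1 + l = k + l + 1 by omega)).symm
      (Fin.natAdd k i).succ = Fin.natAdd (k + 1) i := fun i => by
    ext; simp; omega
  simp only [Equiv.permCongr_apply, e0, e1, e2, finCongr_apply]
  push_cast
  have : ((k : ℝ) + 1) ≠ 0 := by positivity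
  field_simp

open ContinuousAlternatingMap in
/-- The algebraic half of the Leibniz rule, derivative on the right factor. -/
theorem alternatizeUncurryFin_wedge_right (a : V [⋀^Fin k]→L[ℝ] ℝ)
    (B : V →L[ℝ] V [⋀^Fin l]→L[ℝ] ℝ) (v : Fin (k + l + 1) → V) :
    alternatizeUncurryFin (wedgeL a ∘L B) v =
      (-1) ^ k * wedge a (alternatizeUncurryFin B) v := by
  have hl : alternatizeUncurryFin (wedgeL a ∘L B) v =
      ((k.factorial : ℝ) * l.factorial)⁻¹ * ∑ τ : Equiv.Perm (Fin (k + l + 1)),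
        ((Equiv.Perm.sign τ : ℤ) : ℝ) * (a (fun i => v (τ (Fin.castAdd l i).succ)) *
          B (v (τ 0)) (fun j => v (τ (Fin.natAdd k j).succ))) := by
    rw [← sum_sign_perm_succ v (fun x w => a (fun i => w (Fin.castAdd l i)) *
      B x (fun j => w (Fin.natAdd k j))), alternatizeUncurryFin_apply, Finset.mul_sum]
    refine Finset.sum_congr rfl fun i _ => ?_
    simp only [ContinuousLinearMap.comp_apply, wedgeL_apply, wedge_apply, zsmul_eq_mul]
    push_cast
    ring
  rw [hl, wedge_apply]
  simp only [alternatizeUncurryFin_apply, zsmul_eq_mul, Finset.mul_sum]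
  rw [Finset.sum_comm]
  have hr : ∀ i : Fin (l + 1), ∑ σ : Equiv.Perm (Fin (k + (l + 1))), (-1 : ℝ) ^ k *
      (((k.factorial : ℝ) * (l + 1).factorial)⁻¹ * (((Equiv.Perm.sign σ : ℤ) : ℝ) *
        (a (fun j => v (σ (Fin.castAdd (l + 1) j))) *
        ((((-1 : ℤ) ^ (i : ℕ) : ℤ) : ℝ) * B (v (σ (Fin.natAdd k i)))
            (i.removeNth fun i => v (σ (Fin.natAdd k i))))))) =
      ∑ σ : Equiv.Perm (Fin (k + (l + 1))), (-1 : ℝ) ^ k *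
      (((k.factorial : ℝ) * (l + 1).factorial)⁻¹ * (((Equiv.Perm.sign σ : ℤ) : ℝ) *
        (a (fun j => v (σ (Fin.castAdd (l + 1) j))) *
        B (v (σ (Fin.natAdd k 0))) (fun i => v (σ (Fin.natAdd k i.succ)))))) := by
    intro i
    rw [← Finset.mul_sum, ← Finset.mul_sum, ← Finset.mul_sum, ← Finset.mul_sum]
    congr 2
    rw [← sum_sign_right (fun x y => a x * B (y 0) (fun i => y i.succ)) v i.cycleRange.symm]
    refine Finset.sum_congr rfl fun σ _ => ?_
    simp +unfoldPartialApp only [Fin.cycleRange_symm_zero, Fin.cycleRange_symm_succ,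
      Equiv.Perm.sign_symm, Fin.sign_cycleRange, Fin.removeNth]
    push_cast
    ring
  rw [Finset.sum_congr rfl fun i _ => hr i, Finset.sum_const, Finset.card_univ, Fintype.card_fin,
    nsmul_eq_mul, Finset.mul_sum]
  symm
  rw [← Equiv.sum_comp (Equiv.mulRight (Fin.cycleRange (Fin.natAdd k (0 : Fin (l + 1)))))]
  refine Finset.sum_congr rfl fun σ _ => ?_
  have e0 : (Fin.natAdd k (0 : Fin (l + 1))).cycleRange (Fin.natAdd k 0) = 0 :=
    Fin.cycleRange_self _
  have e1 : ∀ i : Fin k, (Fin.natAdd k (0 : Fin (l + 1))).cycleRange (Fin.castAdd (l + 1) i) =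
      (Fin.castAdd l i).succ := fun i => by
    ext
    rw [Fin.coe_cycleRange_of_lt (by simp [Fin.lt_def])]
    simp
  have e2 : ∀ i : Fin l, (Fin.natAdd k (0 : Fin (l + 1))).cycleRange (Fin.natAdd k i.succ) =
      (Fin.natAdd k i).succ := fun i => by
    rw [Fin.cycleRange_of_gt (by simp [Fin.lt_def])]
    ext; simp; omega
  have hs : ((Equiv.Perm.sign (Fin.natAdd k (0 : Fin (l + 1))).cycleRange : ℤ) : ℝ) =
      (-1) ^ k := by
    rw [Fin.sign_cycleRange]
    simp
  have hk : ((-1 : ℝ) ^ k) * (-1) ^ k = 1 := by rw [← mul_pow]; simp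
  simp only [Equiv.coe_mulRight, Equiv.Perm.sign_mul, Units.val_mul, Int.cast_mul, hs,
    Equiv.Perm.mul_apply, e0, e1, e2]
  rw [Nat.factorial_succ]
  push_cast
  have : ((l : ℝ) + 1) ≠ 0 := by positivity
  field_simp
  linear_combination ((a fun j => v (σ (Fin.castAdd l j).succ)) *
    (B (v (σ 0))) fun i => v (σ (Fin.natAdd k i).succ)) * hk

end Wedge
/-! ### Differential forms on the torus -/

/-- The standard torus of dimension `m`, a product of `m` copies of `ℝ / ℤ`. -/
abbrev Torus (m : ℕ) : Type := Fin m → UnitAddCircle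

/-- The universal covering `ℝᵐ → ℝᵐ / ℤᵐ`. -/
def proj {m : ℕ} (x : Fin m → ℝ) : Torus m := fun i => (x i : UnitAddCircle)

theorem proj_surjective {m : ℕ} : Function.Surjective (proj (m := m)) := fun t => by
  choose x hx using fun i => QuotientAddGroup.mk_surjective (t i)
  exact ⟨x, funext hx⟩

theorem proj_add {m : ℕ} (x y : Fin m → ℝ) : proj (x + y) = proj x + proj y := rfl

section Forms

open scoped ContDiff

/-- The smooth differential `k`-forms on the torus. The tangent bundle of the torus
is trivialized by the coordinate fields `∂/∂xⁱ`, so a form is a map from the torus to the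
alternating forms on `ℝᵐ`. The covering `proj` is a local diffeomorphism, so smoothness is tested
after pulling back to `ℝᵐ`. -/
def smoothForms (m k : ℕ) : Submodule ℝ (Torus m → (Fin m → ℝ) [⋀^Fin k]→L[ℝ] ℝ) where
  carrier := {α | ContDiff ℝ ∞ (fun x => α (proj x))}
  add_mem' := fun {a b} (ha : ContDiff ℝ ∞ fun x => a (proj x))
    (hb : ContDiff ℝ ∞ fun x => b (proj x)) => ha.add hb
  zero_mem' := contDiff_zero_fun (𝕜 := ℝ) (n := ∞) (E := Fin m → ℝ)
  smul_mem' := fun c a (ha : ContDiff ℝ ∞ fun x => a (proj x)) => ha.const_smul c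

/-- The real vector space `Aᵏ` of smooth differential `k`-forms on the torus. -/
def Form (m k : ℕ) : Type := smoothForms m k

instance (m k : ℕ) : AddCommGroup (Form m k) := inferInstanceAs (AddCommGroup (smoothForms m k))

instance (m k : ℕ) : Module ℝ (Form m k) := inferInstanceAs (Module ℝ (smoothForms m k))

/-- The pullback of a form to the universal covering. -/
def lift {m k : ℕ} (α : Form m k) (x : Fin m → ℝ) : (Fin m → ℝ) [⋀^Fin k]→L[ℝ] ℝ :=
  α.1 (proj x)

theorem lift_contDiff {m k : ℕ} (α : Form m k) : ContDiff ℝ ∞ (lift α) := α.2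

theorem lift_differentiable {m k : ℕ} (α : Form m k) : Differentiable ℝ (lift α) :=
  (lift_contDiff α).differentiable (by simp)

theorem lift_injective {m k : ℕ} {α β : Form m k} (h : ∀ x, lift α x = lift β x) : α = β := by
  refine Subtype.ext (funext fun t => ?_)
  obtain ⟨x, rfl⟩ := proj_surjective t
  exact h x

theorem extDeriv_lift_congr {m k : ℕ} (α : Form m k) {x y : Fin m → ℝ} (h : proj x = proj y) :
    extDeriv (lift α) x = extDeriv (lift α) y := by
  have hp : (fun z => lift α (z + (y - x))) = lift α := by
    funext z
    have : proj (z + (y - x)) = proj z := by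
      have h2 : proj (y - x) = 0 := by
        have : proj y = proj (y - x) + proj x := by rw [← proj_add, sub_add_cancel]
        rw [h] at this
        simpa using this
      rw [proj_add, h2, add_zero]
    simp only [lift, this]
  have h1 := fderiv_comp_add_right (𝕜 := ℝ) (f := lift α) (x := x) (y - x)
  rw [hp, add_sub_cancel] at h1
  simp only [extDeriv, h1]

theorem contDiff_extDeriv_lift {m k : ℕ} (α : Form m k) : ContDiff ℝ ∞ (extDeriv (lift α)) :=
  ContDiff.comp (g := ContinuousAlternatingMap.alternatizeUncurryFinCLM (n := k) ℝ (Fin m → ℝ) ℝ)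
    (ContinuousLinearMap.contDiff _) ((lift_contDiff α).fderiv_right (m := ∞) (by simp))

theorem extDeriv_lift_surjInv {m k : ℕ} (α : Form m k) (x : Fin m → ℝ) :
    extDeriv (lift α) (Function.surjInv proj_surjective (proj x)) = extDeriv (lift α) x :=
  extDeriv_lift_congr α (Function.surjInv_eq proj_surjective _)

/-- The exterior derivative `d : Aᵏ → Aᵏ⁺¹` on the torus: the form whose pullback to `ℝᵐ` is the
exterior derivative of the pullback, see `lift_d`. -/
def d {m k : ℕ} : Form m k →ₗ[ℝ] Form m (k + 1) where
  toFun α := ⟨fun t => extDeriv (lift α) (Function.surjInv proj_surjective t), by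
    change ContDiff ℝ ∞ fun x => extDeriv (lift α) (Function.surjInv proj_surjective (proj x))
    simp only [extDeriv_lift_surjInv]
    exact contDiff_extDeriv_lift α⟩
  map_add' α β := Subtype.ext (funext fun _ =>
    extDeriv_add (lift_differentiable α _) (lift_differentiable β _))
  map_smul' c α := Subtype.ext (funext fun _ => extDeriv_smul c (lift α))

theorem lift_d {m k : ℕ} (α : Form m k) (x : Fin m → ℝ) : lift (d α) x = extDeriv (lift α) x :=
  extDeriv_lift_surjInv α x

/-- The wedge product of differential forms on the torus. -/
def wedgeForm {m k l : ℕ} (α : Form m k) (β : Form m l) : Form m (k + l) :=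
  ⟨fun t => wedge (α.1 t) (β.1 t),
    contDiff_wedge (lift_contDiff α) (lift_contDiff β)⟩

theorem lift_wedgeForm {m k l : ℕ} (α : Form m k) (β : Form m l) (x : Fin m → ℝ) :
    lift (wedgeForm α β) x = wedge (lift α x) (lift β x) := rfl

/-- The Leibniz rule `d(α ∧ β) = dα ∧ β + (-1)ᵏ α ∧ dβ`. -/
theorem lift_d_wedgeForm {m k l : ℕ} (α : Form m k) (β : Form m l) (x : Fin m → ℝ)
    (v : Fin (k + l + 1) → Fin m → ℝ) :
    lift (d (wedgeForm α β)) x v =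
      lift (wedgeForm (d α) β) x (fun i => v (Fin.cast (by omega) i)) +
        (-1) ^ k * lift (wedgeForm α (d β)) x v := by
  have h : fderiv ℝ (lift (wedgeForm α β)) x =
      wedgeL.flip (lift β x) ∘L fderiv ℝ (lift α) x + wedgeL (lift α x) ∘L fderiv ℝ (lift β) x := by
    refine HasFDerivAt.fderiv ?_
    have := (wedgeL (V := Fin m → ℝ) (k := k) (l := l)).hasFDerivAt_of_bilinear
      (lift_differentiable α x).hasFDerivAt (lift_differentiable β x).hasFDerivAt
    refine this.congr_fderiv ?_
    ext u w
    simp [add_comm]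
  rw [lift_d, lift_wedgeForm, lift_wedgeForm, lift_d, lift_d, extDeriv, h,
    ContinuousAlternatingMap.alternatizeUncurryFin_add, ContinuousAlternatingMap.add_apply,
    alternatizeUncurryFin_wedge_left, alternatizeUncurryFin_wedge_right]
  rfl

/-- The space of closed forms. -/
def closedForms (m k : ℕ) : Submodule ℝ (Form m k) := LinearMap.ker d

/-- The space of exact forms. -/
def exactForms (m : ℕ) : (k : ℕ) → Submodule ℝ (Form m k)
  | 0 => ⊥
  | _ + 1 => LinearMap.range d

theorem mem_exactForms_of_cast {m q r : ℕ} (h : r + 1 = q) (β : Form m q) (γ : Form m r)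
    (hγ : ∀ x v, lift (d γ) x v = lift β x (fun i => v (Fin.cast h.symm i))) :
    β ∈ exactForms m q := by
  subst h
  refine ⟨γ, lift_injective fun x => ?_⟩
  ext v
  exact hγ x v

theorem d_wedgeForm_of_closed {m k l : ℕ} {α : Form m k} {β : Form m l} (hα : d α = 0)
    (hβ : d β = 0) : d (wedgeForm α β) = 0 := by
  refine lift_injective fun x => ?_
  ext v
  rw [lift_d_wedgeForm, hα, hβ, lift_wedgeForm, lift_wedgeForm, ← wedgeL_apply, ← wedgeL_apply]
  have h0 : ∀ j, lift (0 : Form m j) x = 0 := fun _ => rfl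
  simp [h0]

theorem wedgeForm_exact {m k l : ℕ} {α : Form m k} {β : Form m l} (hα : α ∈ exactForms m k)
    (hβ : d β = 0) : wedgeForm α β ∈ exactForms m (k + l) := by
  have h0 : ∀ j x, lift (0 : Form m j) x = 0 := fun _ _ => rfl
  cases k with
  | zero =>
    have hα' : α = 0 := hα
    have : wedgeForm α β = 0 := by
      refine lift_injective fun x => ?_
      rw [lift_wedgeForm, hα', ← wedgeL_apply]
      simp [h0]
    rw [this]
    exact Submodule.zero_mem _
  | succ k =>
    obtain ⟨η, rfl⟩ := hα
    refine mem_exactForms_of_cast (by omega) _ (wedgeForm η β) fun x v => ?_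
    rw [lift_d_wedgeForm, hβ, lift_wedgeForm η, ← wedgeL_apply (lift η x)]
    simp [h0]

/-- The de Rham cohomology `Hᵏ` of the torus: closed forms modulo exact forms. -/
def DeRham (m k : ℕ) : Type := closedForms m k ⧸ (exactForms m k).submoduleOf (closedForms m k)

instance (m k : ℕ) : AddCommGroup (DeRham m k) := inferInstanceAs
  (AddCommGroup (closedForms m k ⧸ (exactForms m k).submoduleOf (closedForms m k)))

instance (m k : ℕ) : Module ℝ (DeRham m k) := inferInstanceAs
  (Module ℝ (closedForms m k ⧸ (exactForms m k).submoduleOf (closedForms m k)))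

/-- The de Rham class of a closed form. -/
def deRhamClass {m k : ℕ} : closedForms m k →ₗ[ℝ] DeRham m k :=
  ((exactForms m k).submoduleOf (closedForms m k)).mkQ

end Forms

/-! ### Symplectic forms and the Hard Lefschetz Condition -/

/-- The power `ωᵏ = ω ∧ ⋯ ∧ ω` of a 2-form. -/
def wedgePow {m : ℕ} (ω : Form m 2) : (k : ℕ) → Form m (2 * k)
  | 0 => ⟨fun _ => ContinuousAlternatingMap.constOfIsEmpty ℝ (Fin m → ℝ) (Fin 0) 1,
      contDiff_const (𝕜 := ℝ) (n := (⊤ : ℕ∞)) (E := Fin m → ℝ)⟩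
  | k + 1 => wedgeForm (wedgePow ω k) ω

theorem d_wedgePow {m : ℕ} {ω : Form m 2} (hω : d ω = 0) (k : ℕ) : d (wedgePow ω k) = 0 := by
  induction k with
  | zero =>
    refine lift_injective fun x => ?_
    rw [lift_d]
    have : lift (wedgePow ω 0) = fun _ =>
      ContinuousAlternatingMap.constOfIsEmpty ℝ (Fin m → ℝ) (Fin 0) (1 : ℝ) := rfl
    rw [this, extDeriv]
    ext v
    simp [ContinuousAlternatingMap.alternatizeUncurryFin_apply]
    rfl
  | succ k ih => exact d_wedgeForm_of_closed ih hω

/-- Wedging with `ωᵏ`, on closed forms. -/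
def lefschetzClosed {m : ℕ} (ω : closedForms m 2) (k p : ℕ) :
    closedForms m p →ₗ[ℝ] closedForms m (p + 2 * k) where
  toFun α := ⟨wedgeForm α.1 (wedgePow ω.1 k), d_wedgeForm_of_closed α.2 (d_wedgePow ω.2 k)⟩
  map_add' α β := Subtype.ext (lift_injective fun x =>
    wedgeL.map_add₂ (lift α.1 x) (lift β.1 x) (lift (wedgePow ω.1 k) x))
  map_smul' c α := Subtype.ext (lift_injective fun x =>
    wedgeL.map_smul₂ c (lift α.1 x) (lift (wedgePow ω.1 k) x))

/-- The Lefschetz map `Lᵏ : Hᵖ → Hᵖ⁺²ᵏ`, `[α] ↦ [α ∧ ωᵏ]`. -/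
def lefschetz {m : ℕ} (ω : closedForms m 2) (k p : ℕ) : DeRham m p →ₗ[ℝ] DeRham m (p + 2 * k) :=
  Submodule.mapQ _ _ (lefschetzClosed ω k p) fun _ hα => wedgeForm_exact hα (d_wedgePow ω.2 k)

theorem lefschetz_deRhamClass {m : ℕ} (ω : closedForms m 2) (k p : ℕ) (α : closedForms m p) :
    lefschetz ω k p (deRhamClass α) = deRhamClass (lefschetzClosed ω k p α) := rfl

/-- The Hard Lefschetz Condition on the torus of dimension `2n`: for `0 ≤ k ≤ n` the map
`Lᵏ : Hⁿ⁻ᵏ → Hⁿ⁺ᵏ` is an isomorphism. Here `p` stands for `n - k`, so that `p + 2k = n + k`. -/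
def HardLefschetz (n : ℕ) (ω : closedForms (2 * n) 2) : Prop :=
  ∀ k p : ℕ, p + k = n → Function.Bijective (lefschetz ω k p)

/-- A 2-form is non-degenerate if at each point no non-zero tangent vector is in its kernel.
A closed form which is non-degenerate is symplectic. -/
def IsSymplectic {m : ℕ} (ω : closedForms m 2) : Prop :=
  ∀ t : Torus m, ∀ u : Fin m → ℝ, (∀ v, ω.1.1 t ![u, v] = 0) → u = 0

/-- The form has constant coefficients in the basis `dxⁱ ∧ dxʲ`, `i < j`. -/
def IsConstantCoefficient {m k : ℕ} (α : Form m k) : Prop :=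
  ∃ c : (Fin m → ℝ) [⋀^Fin k]→L[ℝ] ℝ, ∀ t, α.1 t = c

/-! ### Compatible complex structures and Kähler forms -/

section ComplexStructures

open scoped ContDiff

/-- A (smooth) almost complex structure on the torus: a field of endomorphisms of the tangent
spaces with `J² = -id`. -/
structure AlmostComplex (m : ℕ) where
  J : Torus m → (Fin m → ℝ) →L[ℝ] (Fin m → ℝ)
  smooth : ContDiff ℝ ∞ (fun x => J (proj x))
  sq : ∀ t v, J t (J t v) = -v

/-- `J` is integrable: around every point there are local coordinates with values in `ℂⁿ` which
are holomorphic for `J`, i.e. whose differential intertwines `J` with multiplication by `i`.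
As `proj` is a local diffeomorphism, coordinates on the torus are written on `ℝ²ⁿ`. -/
def AlmostComplex.Integrable {n : ℕ} (J : AlmostComplex (2 * n)) : Prop :=
  ∀ x : Fin (2 * n) → ℝ, ∃ φ : OpenPartialHomeomorph (Fin (2 * n) → ℝ) (Fin n → ℂ),
    x ∈ φ.source ∧ ContDiffOn ℝ ∞ φ φ.source ∧ ContDiffOn ℝ ∞ φ.symm φ.target ∧
      ∀ y ∈ φ.source, ∀ v, fderiv ℝ φ y (J.J (proj y) v) = Complex.I • fderiv ℝ φ y v

end ComplexStructures

/-- `J` is `ω`-compatible: it preserves `ω`, and `ω(w, Jw) > 0` for `w ≠ 0`; that is,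
`g(u, v) = ω(u, Jv)` is a `J`-invariant Riemannian metric. -/
def AlmostComplex.Compatible {m : ℕ} (J : AlmostComplex m) (ω : Form m 2) : Prop :=
  (∀ t u v, ω.1 t ![J.J t u, J.J t v] = ω.1 t ![u, v]) ∧
    ∀ t w, w ≠ 0 → 0 < ω.1 t ![w, J.J t w]

/-- A Kähler form: a symplectic form which admits an integrable compatible (almost) complex
structure. -/
def IsKahler {n : ℕ} (ω : closedForms (2 * n) 2) : Prop :=
  IsSymplectic ω ∧ ∃ J : AlmostComplex (2 * n), J.Integrable ∧ J.Compatible ω.1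

end TorusHLC

end

/-!
The proof reduces both claims to linear algebra over `ℝ²ⁿ`.

*Cohomology.* Every class on the torus contains exactly one form with constant coefficients
(`bijective_constClass`), namely the average of any of its members over the torus. Averaging is done
over one coordinate circle at a time: for a closed form `α` and a constant vector field `e`,
Cartan's formula and integration by parts give
`∫₀¹ α(x + re) dr - α(x) = d ∫₀¹ (1 - r) (ι_e α)(x + re) dr`, where the right side is again periodic
(`smear_sub_mem_exactForms`). An average over all coordinates is constant, and averaging commutes
with `d`, so that exact forms average to zero. Since wedging with closed forms respects exactness,
`Lᵏ` becomes the map `a ↦ a ∧ cᵏ` on constant forms, with `c` the constant form cohomologous to `ω`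
(`lefschetz_constClass`).

*Non-degeneracy of `c`.* The form `ωⁿ` is a volume form, so its coefficient has constant sign and
its average is not zero. If `cⁿ` were zero, then `ωⁿ` would be exact and average to zero. Hence
`cⁿ ≠ 0`, and `c` is non-degenerate (`nondegenerate_of_isSymplectic`).

*Linear Hard Lefschetz.* The operator `L = (· ∧ c)` is a quadratic expression in creation operators
`θ ∧ ·`, its dual `Λ` a quadratic expression in annihilation operators `ι_u`; the canonical
anticommutation relations give `[Λ, L] = n - deg`, a representation of `sl₂`. A short induction
(`eq_zero_of_raise_pow_eq_zero`) shows that `Lᵏ` is injective in degree `n - k`. By symmetry `Λᵏ`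
is injective in degree `n + k`, so the two spaces have the same dimension and `Lᵏ` is bijective
(`bijective_wedge_altPow`).

*The Kähler structure.* A symplectic vector space is isomorphic to `ℂⁿ` with the imaginary part of
the Hermitian form (`exists_complex_coordinates`). Multiplication by `i` yields a constant,
hence integrable, compatible complex structure (`isKahler_constForm`).
-/

noncomputable section

namespace TorusHLC

/-! ### Weighted averages along a line -/

section LineAverage

open scoped ContDiff

variable {V W : Type} [NormedAddCommGroup V] [NormedSpace ℝ V] [NormedAddCommGroup W]
  [NormedSpace ℝ W] {w : ℝ → ℝ} {f : V → W}

theorem continuous_weight_smul_line (hw : Continuous w) (e : V) (hf : Continuous f) (x : V) :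
    Continuous fun r : ℝ => w r • f (x + r • e) := by fun_prop

/-- Differentiation under the integral sign. -/
theorem hasFDerivAt_lineAverage [ProperSpace V] (hw : Continuous w) (e : V) (hf : ContDiff ℝ 1 f)
    (x : V) :
    HasFDerivAt (fun x => ∫ r in (0 : ℝ)..1, w r • f (x + r • e))
      (∫ r in (0 : ℝ)..1, w r • fderiv ℝ f (x + r • e)) x := by
  have hf' : Continuous (fderiv ℝ f) := hf.continuous_fderiv (by simp)
  have hc : Continuous fun p : V × ℝ => w p.2 • fderiv ℝ f (p.1 + p.2 • e) := by fun_prop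
  have hK : IsCompact (Metric.closedBall x 1 ×ˢ Set.uIcc (0 : ℝ) 1) :=
    (isCompact_closedBall x 1).prod isCompact_uIcc
  obtain ⟨C, hC⟩ := hK.exists_bound_of_continuousOn hc.continuousOn
  refine intervalIntegral.hasFDerivAt_integral_of_dominated_of_fderiv_le (𝕜 := ℝ)
    (F' := fun x r => w r • fderiv ℝ f (x + r • e)) (bound := fun _ => C)
    (Metric.closedBall_mem_nhds x one_pos)
    (.of_forall fun y => (continuous_weight_smul_line hw e hf.continuous y).aestronglyMeasurable)
    ((continuous_weight_smul_line hw e hf.continuous x).intervalIntegrable _ _)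
    (continuous_weight_smul_line hw e hf' x).aestronglyMeasurable
    (.of_forall fun r hr y hy => hC (y, r) ⟨hy, Set.uIoc_subset_uIcc hr⟩)
    intervalIntegrable_const
    (.of_forall fun r _ y _ => ?_)
  have h := (hf.differentiable (by simp) (y + r • e)).hasFDerivAt
  exact (h.comp y ((hasFDerivAt_id y).add_const (r • e))).const_smul (w r)

theorem contDiff_lineAverage [ProperSpace V] (hw : Continuous w) (e : V) (hf : ContDiff ℝ ∞ f) :
    ContDiff ℝ ∞ fun x => ∫ r in (0 : ℝ)..1, w r • f (x + r • e) := by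
  rw [contDiff_infty]
  intro n
  induction n generalizing W with
  | zero =>
    rw [Nat.cast_zero, contDiff_zero]
    exact continuous_iff_continuousAt.2 fun x =>
      (hasFDerivAt_lineAverage hw e (hf.of_le (by simp)) x).continuousAt
  | succ n ih =>
    rw [Nat.cast_succ, contDiff_succ_iff_fderiv]
    have hd := hasFDerivAt_lineAverage hw e (hf.of_le (by simp) : ContDiff ℝ 1 f)
    refine ⟨fun x => (hd x).differentiableAt, by simp, ?_⟩
    rw [show fderiv ℝ (fun x => ∫ r in (0 : ℝ)..1, w r • f (x + r • e)) = _ from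
      funext fun x => (hd x).fderiv]
    exact ih (hf.fderiv_right (by simp))

theorem map_integral_weight_smul_fderiv {Z : Type} [NormedAddCommGroup Z] [NormedSpace ℝ Z]
    [CompleteSpace W] [CompleteSpace Z] (hw : Continuous w) (e : V) (hf : ContDiff ℝ 1 f) (x : V)
    (T : (V →L[ℝ] W) →L[ℝ] Z) :
    T (∫ r in (0 : ℝ)..1, w r • fderiv ℝ f (x + r • e)) =
      ∫ r in (0 : ℝ)..1, w r • T (fderiv ℝ f (x + r • e)) := by
  have hf' : Continuous (fderiv ℝ f) := hf.continuous_fderiv (by simp)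
  rw [← T.intervalIntegral_comp_comm
    ((continuous_weight_smul_line hw e hf' x).intervalIntegrable _ _)]
  simp only [map_smul]

end LineAverage

/-! ### Cartan's formula -/

section Cartan

open ContinuousAlternatingMap

variable {V : Type*} [NormedAddCommGroup V] [NormedSpace ℝ V] {k : ℕ}

/-- The interior product with `u`, as a linear map. -/
def interior (u : V) : (V [⋀^Fin (k + 1)]→L[ℝ] ℝ) →L[ℝ] V [⋀^Fin k]→L[ℝ] ℝ :=
  (ContinuousLinearMap.apply ℝ _ u) ∘L
    (curryLeftLI (𝕜 := ℝ) (E := V) (F := ℝ) (n := k)).toContinuousLinearMap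

theorem interior_apply (u : V) (a : V [⋀^Fin (k + 1)]→L[ℝ] ℝ) (v : Fin k → V) :
    interior u a v = a (Matrix.vecCons u v) := rfl

theorem interior_alternatizeUncurryFin_zero (u : V) (f : V →L[ℝ] V [⋀^Fin 0]→L[ℝ] ℝ) :
    interior u (alternatizeUncurryFin f) = f u := by
  ext v
  simp [interior_apply, alternatizeUncurryFin_apply]

/-- The algebraic form of Cartan's formula: applied to the derivative of a form, the left side is
`ι_u d`, the last term is `d ι_u`, and the middle term is the derivative in the direction `u`. -/
theorem interior_alternatizeUncurryFin_succ (u : V) (f : V →L[ℝ] V [⋀^Fin (k + 1)]→L[ℝ] ℝ) :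
    interior u (alternatizeUncurryFin f) = f u - alternatizeUncurryFin (interior u ∘L f) := by
  ext v
  simp only [interior_apply, alternatizeUncurryFin_apply,
    ContinuousAlternatingMap.sub_apply, ContinuousLinearMap.comp_apply]
  rw [Fin.sum_univ_succ, sub_eq_add_neg, ← Finset.sum_neg_distrib]
  congr 1
  · simp
  · refine Finset.sum_congr rfl fun i _ => ?_
    have : i.succ.removeNth (Matrix.vecCons u v) = Matrix.vecCons u (i.removeNth v) := by
      funext j
      refine Fin.cases ?_ (fun j => ?_) j <;> simp [Fin.removeNth, Matrix.vecCons]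
    rw [this]
    simp [pow_succ]

end Cartan

/-! ### Averaging forms over the coordinate circles -/

section Average

open scoped ContDiff

variable {m k : ℕ}

/-- The form `∫₀¹ w(r) τ_{re}^* α dr`, where `τ_{re}` is the translation by `re`. -/
def smear (w : C(ℝ, ℝ)) (e : Fin m → ℝ) (α : Form m k) : Form m k :=
  ⟨fun t => ∫ r in (0 : ℝ)..1, w r • α.1 (t + proj (r • e)),
    contDiff_lineAverage w.continuous e (lift_contDiff α)⟩

theorem lift_smear (w : C(ℝ, ℝ)) (e : Fin m → ℝ) (α : Form m k) (x : Fin m → ℝ) :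
    lift (smear w e α) x = ∫ r in (0 : ℝ)..1, w r • lift α (x + r • e) := rfl

theorem fderiv_lift_smear (w : C(ℝ, ℝ)) (e : Fin m → ℝ) (α : Form m k) (x : Fin m → ℝ) :
    fderiv ℝ (lift (smear w e α)) x =
      ∫ r in (0 : ℝ)..1, w r • fderiv ℝ (lift α) (x + r • e) :=
  (hasFDerivAt_lineAverage w.continuous e ((lift_contDiff α).of_le (by simp)) x).fderiv

theorem continuous_fderiv_lift (α : Form m k) : Continuous (fderiv ℝ (lift α)) :=
  (lift_contDiff α).continuous_fderiv (by simp)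

theorem fderiv_lift_smear_apply (w : C(ℝ, ℝ)) (e : Fin m → ℝ) (α : Form m k) (x v : Fin m → ℝ) :
    fderiv ℝ (lift (smear w e α)) x v =
      ∫ r in (0 : ℝ)..1, w r • fderiv ℝ (lift α) (x + r • e) v := by
  rw [fderiv_lift_smear]
  exact ContinuousLinearMap.intervalIntegral_apply
    ((continuous_weight_smul_line w.continuous e (continuous_fderiv_lift α) x).intervalIntegrable
      _ _) v

theorem d_smear (w : C(ℝ, ℝ)) (e : Fin m → ℝ) (α : Form m k) :
    d (smear w e α) = smear w e (d α) := by
  refine lift_injective fun x => ?_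
  rw [lift_d, extDeriv, fderiv_lift_smear,
    ← ContinuousAlternatingMap.alternatizeUncurryFinCLM_apply]
  refine (map_integral_weight_smul_fderiv w.continuous e
    ((lift_contDiff α).of_le (by simp)) x _).trans ?_
  simp only [lift_smear, lift_d]
  rfl

/-- The interior product of a form with the constant vector field `e`. -/
def contract (e : Fin m → ℝ) (α : Form m (k + 1)) : Form m k :=
  ⟨fun t => interior e (α.1 t), (interior e).contDiff.comp (lift_contDiff α)⟩

theorem lift_contract (e : Fin m → ℝ) (α : Form m (k + 1)) :
    lift (contract e α) = interior e ∘ lift α := rfl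

/-- On closed forms, the Lie derivative along a constant vector field is `d ι_e`. -/
theorem lift_d_contract_of_closed (e : Fin m → ℝ) {α : Form m (k + 1)} (hα : d α = 0)
    (x : Fin m → ℝ) : lift (d (contract e α)) x = fderiv ℝ (lift α) x e := by
  have h := interior_alternatizeUncurryFin_succ e (fderiv ℝ (lift α) x)
  have h0 : ContinuousAlternatingMap.alternatizeUncurryFin (fderiv ℝ (lift α) x) = 0 := by
    rw [← extDeriv, ← lift_d, hα]; rfl
  rw [h0, map_zero, eq_comm, sub_eq_zero] at h
  rw [h, lift_d, extDeriv, lift_contract]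
  congr 1
  exact (interior e).hasFDerivAt.comp x (lift_differentiable α x).hasFDerivAt |>.fderiv

theorem fderiv_lift_of_closed_zero {α : Form m 0} (hα : d α = 0) (x : Fin m → ℝ) :
    fderiv ℝ (lift α) x = 0 := by
  ext1 u
  rw [← interior_alternatizeUncurryFin_zero u (fderiv ℝ (lift α) x), ← extDeriv, ← lift_d, hα]
  exact map_zero _

theorem hasDerivAt_lift_line (α : Form m k) (x e : Fin m → ℝ) (r : ℝ) :
    HasDerivAt (fun r : ℝ => lift α (x + r • e)) (fderiv ℝ (lift α) (x + r • e) e) r := by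
  have h1 : HasDerivAt (fun r : ℝ => x + r • e) e r := by
    simpa using ((hasDerivAt_id r).smul_const e).const_add x
  exact (lift_differentiable α (x + r • e)).hasFDerivAt.comp_hasDerivAt r h1

/-- The constant weight. -/
def constWeight : C(ℝ, ℝ) := ⟨fun _ => 1, continuous_const⟩

/-- The weight `1 - r`, which turns the average of the Lie derivative along a flow line into the
average of the form minus the form. -/
def homotopyWeight : C(ℝ, ℝ) := ⟨fun r => 1 - r, by fun_prop⟩

/-- Integration by parts along a line segment. -/
theorem integral_homotopyWeight_fderiv (α : Form m k) (x e : Fin m → ℝ) :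
    ∫ r in (0 : ℝ)..1, homotopyWeight r • fderiv ℝ (lift α) (x + r • e) e =
      lift (smear constWeight e α) x - lift α x := by
  have hd : ∀ r ∈ Set.uIcc (0 : ℝ) 1, HasDerivAt (fun r : ℝ => (1 - r) • lift α (x + r • e))
      ((1 - r) • fderiv ℝ (lift α) (x + r • e) e + (-1 : ℝ) • lift α (x + r • e)) r :=
    fun r _ => ((hasDerivAt_id r).const_sub 1).smul (hasDerivAt_lift_line α x e r)
  have hc := continuous_fderiv_lift α
  have hc' := (lift_differentiable α).continuous
  have h1 : Continuous fun r : ℝ => (1 - r) • fderiv ℝ (lift α) (x + r • e) e := by fun_prop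
  have h2 : Continuous fun r : ℝ => (-1 : ℝ) • lift α (x + r • e) := by fun_prop
  have h := intervalIntegral.integral_eq_sub_of_hasDerivAt hd ((h1.add h2).intervalIntegrable _ _)
  rw [intervalIntegral.integral_add (h1.intervalIntegrable _ _) (h2.intervalIntegrable _ _),
    intervalIntegral.integral_smul] at h
  rw [lift_smear]
  simp only [homotopyWeight, constWeight, ContinuousMap.coe_mk, one_smul]
  simp only [sub_self, zero_smul, sub_zero, add_zero, one_smul, neg_smul] at h
  rw [← sub_eq_add_neg, sub_eq_iff_eq_add] at h
  rw [h]
  abel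

/-- Closed forms are cohomologous to their averages along a constant vector field. -/
theorem smear_sub_mem_exactForms (e : Fin m → ℝ) {α : Form m k} (hα : d α = 0) :
    smear constWeight e α - α ∈ exactForms m k := by
  cases k with
  | zero =>
    have : smear constWeight e α - α = 0 := by
      refine lift_injective fun x => ?_
      have h := integral_homotopyWeight_fderiv α x e
      simp only [fderiv_lift_of_closed_zero hα] at h
      change lift (smear constWeight e α) x - lift α x = 0
      rw [← h]
      simp
    rw [this]
    exact Submodule.zero_mem _
  | succ k =>
    refine ⟨smear homotopyWeight e (contract e α), lift_injective fun x => ?_⟩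
    rw [d_smear, lift_smear]
    simp only [lift_d_contract_of_closed e hα]
    exact integral_homotopyWeight_fderiv α x e

theorem proj_single (i : Fin m) : proj (Pi.single i (1 : ℝ)) = 0 := by
  funext j
  by_cases h : j = i
  · subst h; simp [proj]
  · simp [proj, h]

/-- The average along a coordinate circle is invariant under translations along that circle; this is
where periodicity enters. -/
theorem fderiv_lift_smear_self (i : Fin m) (α : Form m k) (x : Fin m → ℝ) :
    fderiv ℝ (lift (smear constWeight (Pi.single i 1) α)) x (Pi.single i 1) = 0 := by
  have hc := continuous_fderiv_lift α
  have h := intervalIntegral.integral_eq_sub_of_hasDerivAt (a := 0) (b := 1)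
    (fun r _ => hasDerivAt_lift_line α x (Pi.single i 1) r)
    (Continuous.intervalIntegrable (by fun_prop) _ _)
  rw [fderiv_lift_smear_apply]
  simp only [constWeight, ContinuousMap.coe_mk, one_smul]
  rw [h]
  simp [lift, proj_add, proj_single]

theorem fderiv_lift_smear_eq_zero (e v : Fin m → ℝ) {α : Form m k}
    (h : ∀ x, fderiv ℝ (lift α) x v = 0) (x : Fin m → ℝ) :
    fderiv ℝ (lift (smear constWeight e α)) x v = 0 := by
  rw [fderiv_lift_smear_apply]
  simp [h]

/-- The average of a form over the circles in the coordinate directions listed in `s`. -/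
def average : List (Fin m) → Form m k → Form m k
  | [], α => α
  | i :: s, α => smear constWeight (Pi.single i 1) (average s α)

theorem d_average (s : List (Fin m)) (α : Form m k) : d (average s α) = average s (d α) := by
  induction s with
  | nil => rfl
  | cons i s ih => rw [average, d_smear, ih, average]

theorem average_zero (s : List (Fin m)) : average s (0 : Form m k) = 0 := by
  induction s with
  | nil => rfl
  | cons i s ih =>
    rw [average, ih]
    refine lift_injective fun x => ?_
    rw [lift_smear]
    change ∫ r in (0 : ℝ)..1, _ • (0 : (Fin m → ℝ) [⋀^Fin k]→L[ℝ] ℝ) = 0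
    simp

theorem average_sub_mem_exactForms (s : List (Fin m)) {α : Form m k} (hα : d α = 0) :
    average s α - α ∈ exactForms m k := by
  induction s with
  | nil => simp [average]
  | cons i s ih =>
    have hs : d (average s α) = 0 := by rw [d_average, hα, average_zero]
    have := Submodule.add_mem _ (smear_sub_mem_exactForms (Pi.single i 1) hs) ih
    rwa [sub_add_sub_cancel] at this

theorem fderiv_lift_average (s : List (Fin m)) {i : Fin m} (hi : i ∈ s) (α : Form m k)
    (x : Fin m → ℝ) : fderiv ℝ (lift (average s α)) x (Pi.single i 1) = 0 := by
  induction s generalizing x with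
  | nil => simp at hi
  | cons j s ih =>
    by_cases h : i = j
    · subst h
      exact fderiv_lift_smear_self _ _ _
    · exact fderiv_lift_smear_eq_zero _ _ (ih (by simpa [h] using hi)) x

/-- The form with constant coefficients given by an alternating form on `ℝᵐ`. -/
def constForm (c : (Fin m → ℝ) [⋀^Fin k]→L[ℝ] ℝ) : Form m k := ⟨fun _ => c,
  contDiff_const (𝕜 := ℝ) (n := ∞) (E := Fin m → ℝ)⟩

theorem lift_constForm (c : (Fin m → ℝ) [⋀^Fin k]→L[ℝ] ℝ) (x : Fin m → ℝ) :
    lift (constForm c) x = c := rfl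

theorem d_constForm (c : (Fin m → ℝ) [⋀^Fin k]→L[ℝ] ℝ) : d (constForm c) = 0 := by
  refine lift_injective fun x => ?_
  rw [lift_d, extDeriv, show lift (constForm c) = fun _ => c from rfl, fderiv_fun_const,
    ← ContinuousAlternatingMap.alternatizeUncurryFinCLM_apply]
  exact map_zero _

theorem exists_average_finRange_eq_constForm (α : Form m k) :
    ∃ c, average (List.finRange m) α = constForm c := by
  refine ⟨lift (average (List.finRange m) α) 0, lift_injective fun x => ?_⟩
  refine is_const_of_fderiv_eq_zero (𝕜 := ℝ) (lift_differentiable _) (fun y => ?_) x 0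
  refine ContinuousLinearMap.coe_injective ((Pi.basisFun ℝ (Fin m)).ext fun i => ?_)
  simpa using fderiv_lift_average (List.finRange m) (List.mem_finRange i) α y

theorem average_constForm (s : List (Fin m)) (c : (Fin m → ℝ) [⋀^Fin k]→L[ℝ] ℝ) :
    average s (constForm c) = constForm c := by
  induction s with
  | nil => rfl
  | cons i s ih =>
    rw [average, ih]
    refine lift_injective fun x => ?_
    simp [lift_smear, lift_constForm, constWeight]

/-- Averaging over the whole torus kills exact forms. -/
theorem average_finRange_eq_zero_of_exact {α : Form m k} (hα : α ∈ exactForms m k) :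
    average (List.finRange m) α = 0 := by
  cases k with
  | zero =>
    rw [show α = 0 from hα, average_zero]
  | succ k =>
    obtain ⟨η, rfl⟩ := hα
    obtain ⟨c, hc⟩ := exists_average_finRange_eq_constForm η
    rw [← d_average, hc, d_constForm]

/-- Averaging preserves the sign of a coefficient. The factor `a` covers both signs. -/
theorem lift_average_pos (s : List (Fin m)) {α : Form m k} (a : ℝ) (v : Fin k → Fin m → ℝ)
    (h : ∀ x, 0 < a * lift α x v) (x : Fin m → ℝ) : 0 < a * lift (average s α) x v := by
  induction s generalizing x with
  | nil => exact h x
  | cons i s ih =>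
    have hc : Continuous (lift (average s α)) := (lift_differentiable _).continuous
    have h1 : lift (smear constWeight (Pi.single i 1) (average s α)) x v =
        ∫ r in (0 : ℝ)..1, lift (average s α) (x + r • Pi.single i 1) v := by
      rw [lift_smear]
      simp only [constWeight, ContinuousMap.coe_mk, one_smul]
      exact ((ContinuousAlternatingMap.apply ℝ (Fin m → ℝ) ℝ v).intervalIntegral_comp_comm
        (Continuous.intervalIntegrable (by fun_prop) _ _)).symm
    rw [average, h1, ← intervalIntegral.integral_const_mul]
    have h2 : Continuous fun r : ℝ => lift (average s α) (x + r • Pi.single i 1) v :=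
      (ContinuousAlternatingMap.apply ℝ (Fin m → ℝ) ℝ v).continuous.comp
        (hc.comp (by fun_prop : Continuous fun r : ℝ => x + r • Pi.single i (1 : ℝ)))
    exact intervalIntegral.intervalIntegral_pos_of_pos
      ((continuous_const.mul h2).intervalIntegrable _ _) (fun r => ih _) one_pos

/-- Every closed form on the torus is cohomologous to a form with constant coefficients. -/
theorem exists_sub_constForm_mem_exactForms {α : Form m k} (hα : d α = 0) :
    ∃ c, α - constForm c ∈ exactForms m k := by
  obtain ⟨c, hc⟩ := exists_average_finRange_eq_constForm α
  refine ⟨c, ?_⟩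
  rw [← hc, ← neg_sub]
  exact Submodule.neg_mem _ (average_sub_mem_exactForms _ hα)

theorem eq_zero_of_constForm_mem_exactForms {c : (Fin m → ℝ) [⋀^Fin k]→L[ℝ] ℝ}
    (h : constForm c ∈ exactForms m k) : c = 0 := by
  have := average_finRange_eq_zero_of_exact h
  rw [average_constForm] at this
  exact congrArg (fun α => lift α 0) this

end Average

/-! ### Creation and annihilation operators on alternating forms -/

section Fock

open ContinuousAlternatingMap (alternatizeUncurryFin alternatizeUncurryFin_add
  alternatizeUncurryFin_smul alternatizeUncurryFinCLM_apply alternatizeUncurryFin_curryLeft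
  curryLeft)

variable {V : Type*} [NormedAddCommGroup V] [NormedSpace ℝ V] {k l : ℕ}

/-- The wedge product `θ ∧ a` of a covector and an alternating form. -/
def covectorWedge : (V →L[ℝ] ℝ) →ₗ[ℝ] (V [⋀^Fin k]→L[ℝ] ℝ) →ₗ[ℝ] V [⋀^Fin (k + 1)]→L[ℝ] ℝ :=
  LinearMap.mk₂ ℝ (fun θ a => alternatizeUncurryFin (θ.smulRight a))
    (fun θ θ' a => by
      rw [← alternatizeUncurryFin_add]; congr 1; ext; simp [add_mul])
    (fun c θ a => by
      rw [← alternatizeUncurryFin_smul]; congr 1; ext; simp [mul_assoc])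
    (fun θ a a' => by
      rw [← alternatizeUncurryFin_add]; congr 1; ext; simp)
    (fun c θ a => by
      rw [← alternatizeUncurryFin_smul]; congr 1; ext; simp [mul_left_comm])

theorem covectorWedge_apply (θ : V →L[ℝ] ℝ) (a : V [⋀^Fin k]→L[ℝ] ℝ) :
    covectorWedge θ a = alternatizeUncurryFin (θ.smulRight a) := rfl

variable (V) in
/-- Sequences of alternating forms, one in each degree. For a finite-dimensional `V` only finitely
many degrees are non-zero, and this is the exterior algebra of the dual of `V`. -/
abbrev GradedForms : Type _ := (k : ℕ) → V [⋀^Fin k]→L[ℝ] ℝ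

/-- The creation operator `a ↦ θ ∧ a`. -/
def creation : (V →L[ℝ] ℝ) →ₗ[ℝ] GradedForms V →ₗ[ℝ] GradedForms V :=
  LinearMap.mk₂ ℝ (fun θ a k => match k with
      | 0 => 0
      | k + 1 => covectorWedge θ (a k))
    (fun θ θ' a => by funext k; cases k <;> simp)
    (fun c θ a => by funext k; cases k <;> simp)
    (fun θ a a' => by funext k; cases k <;> simp)
    (fun c θ a => by funext k; cases k <;> simp)

theorem creation_zero (θ : V →L[ℝ] ℝ) (a : GradedForms V) : creation θ a 0 = 0 := rfl

theorem creation_succ (θ : V →L[ℝ] ℝ) (a : GradedForms V) (k : ℕ) :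
    creation θ a (k + 1) = covectorWedge θ (a k) := rfl

/-- The annihilation operator `a ↦ ι_u a`. -/
def annihilation (u : V) : GradedForms V →ₗ[ℝ] GradedForms V :=
  LinearMap.pi fun k => (interior u).toLinearMap ∘ₗ LinearMap.proj (k + 1)

theorem annihilation_apply (u : V) (a : GradedForms V) (k : ℕ) :
    annihilation u a k = interior u (a (k + 1)) := rfl

/-- The operator which multiplies the component of degree `k` by `k`. -/
def degree : GradedForms V →ₗ[ℝ] GradedForms V :=
  LinearMap.pi fun k => (k : ℝ) • LinearMap.proj k

theorem degree_apply (a : GradedForms V) (k : ℕ) : degree a k = (k : ℝ) • a k := rfl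

/-- The canonical anticommutation relation `ι_u θ + θ ι_u = θ(u)`. -/
theorem annihilation_creation (u : V) (θ : V →L[ℝ] ℝ) (a : GradedForms V) :
    annihilation u (creation θ a) = θ u • a - creation θ (annihilation u a) := by
  funext k
  rw [annihilation_apply, creation_succ, covectorWedge_apply, Pi.sub_apply, Pi.smul_apply]
  cases k with
  | zero => rw [interior_alternatizeUncurryFin_zero, creation_zero, sub_zero]; rfl
  | succ k =>
    rw [interior_alternatizeUncurryFin_succ, creation_succ, covectorWedge_apply,
      annihilation_apply]
    congr 2

/-- Euler's identity: the operator `∑ᵢ θᵢ ∧ ι_{uᵢ}`, for `∑ᵢ θᵢ ⊗ uᵢ` the identity of `V`,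
multiplies by the degree. -/
theorem sum_creation_annihilation {ι : Type*} [Fintype ι] {θ : ι → V →L[ℝ] ℝ} {u : ι → V}
    (h : ∀ v, ∑ i, θ i v • u i = v) (a : GradedForms V) :
    ∑ i, creation (θ i) (annihilation (u i) a) = degree a := by
  funext k
  rw [Finset.sum_apply, degree_apply]
  cases k with
  | zero => simp [creation_zero]
  | succ k =>
    simp only [creation_succ, covectorWedge_apply, annihilation_apply]
    have h1 : ∑ i, (θ i).smulRight (interior (u i) (a (k + 1))) = curryLeft (a (k + 1)) := by
      ext1 v
      conv_rhs => rw [← h v]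
      simp [interior]
    simp only [← alternatizeUncurryFinCLM_apply]
    rw [← map_sum, h1, alternatizeUncurryFinCLM_apply, alternatizeUncurryFin_curryLeft]
    norm_cast

/-! ### Wedging with a 2-form -/

/-- Wedging commutes with alternatization up to sign. The two sides have definitionally equal degrees. -/
theorem wedge_alternatizeUncurryFin (a : V [⋀^Fin k]→L[ℝ] ℝ) (B : V →L[ℝ] V [⋀^Fin l]→L[ℝ] ℝ) :
    wedge a (alternatizeUncurryFin B) =
      (-1 : ℝ) ^ k • (alternatizeUncurryFin (wedgeL a ∘L B) : V [⋀^Fin (k + l + 1)]→L[ℝ] ℝ) := by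
  ext v
  rw [ContinuousAlternatingMap.smul_apply]
  -- `erw` identifies `k + (l + 1)` with `k + l + 1`.
  erw [alternatizeUncurryFin_wedge_right a B v]
  rw [smul_eq_mul, ← mul_assoc, ← mul_pow]
  simp

theorem wedge_degree_zero (a : V [⋀^Fin k]→L[ℝ] ℝ) (c : V [⋀^Fin 0]→L[ℝ] ℝ) :
    wedge a c = c ![] • a := by
  ext v
  rw [wedge_apply]
  have h : ∀ σ : Equiv.Perm (Fin (k + 0)), ((Equiv.Perm.sign σ : ℤ) : ℝ) *
      (a (fun i => v (σ (Fin.castAdd 0 i))) * c (fun j => v (σ (Fin.natAdd k j)))) =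
      c ![] * a v := fun σ => by
    have h1 : a (fun i => v (σ (Fin.castAdd 0 i))) = Equiv.Perm.sign σ • a v :=
      a.toAlternatingMap.map_perm v σ
    have h2 : (fun j => v (σ (Fin.natAdd k j))) = ![] := Subsingleton.elim _ _
    have h3 : ((Equiv.Perm.sign σ : ℤ) : ℝ) * ((Equiv.Perm.sign σ : ℤ) : ℝ) = 1 := by
      rcases Int.units_eq_one_or (Equiv.Perm.sign σ) with h | h <;> simp [h]
    rw [h1, h2, Units.smul_def, zsmul_eq_mul]
    linear_combination (c ![] * a v) * h3
  rw [Finset.sum_congr rfl fun σ _ => h σ]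
  have : (k.factorial : ℝ) ≠ 0 := by positivity
  simp [Fintype.card_perm]
  field_simp

theorem wedge_covectorWedge (a : V [⋀^Fin k]→L[ℝ] ℝ) (θ : V →L[ℝ] ℝ) (b : V [⋀^Fin l]→L[ℝ] ℝ) :
    wedge a (covectorWedge θ b) =
      (-1 : ℝ) ^ k • (covectorWedge θ (wedge a b) : V [⋀^Fin (k + l + 1)]→L[ℝ] ℝ) := by
  rw [covectorWedge_apply, wedge_alternatizeUncurryFin, covectorWedge_apply]
  congr 2
  ext1 v
  simp [wedgeL_apply]

/-- The covector `ω(u, ·)`. -/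
def flat (ω : V [⋀^Fin 2]→L[ℝ] ℝ) (u : V) : V →L[ℝ] ℝ :=
  ContinuousAlternatingMap.apply ℝ V ℝ ![] ∘L curryLeft (interior u ω)

theorem flat_apply (ω : V [⋀^Fin 2]→L[ℝ] ℝ) (u v : V) : flat ω u v = ω ![u, v] := rfl

theorem flat_antisymm (ω : V [⋀^Fin 2]→L[ℝ] ℝ) (u v : V) : flat ω u v = -flat ω v u := by
  rw [flat_apply, flat_apply]
  refine Eq.trans (congrArg ω ?_) (ω.map_swap ![v, u] (show (0 : Fin 2) ≠ 1 by decide))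
  funext i
  fin_cases i <;> simp

theorem flat_sum {ι : Type*} [Fintype ι] (ω : V [⋀^Fin 2]→L[ℝ] ℝ) (c : ι → ℝ) (u : ι → V) :
    flat ω (∑ i, c i • u i) = ∑ i, c i • flat ω (u i) := by
  ext v
  rw [flat_antisymm, map_sum, sum_apply, ← Finset.sum_neg_distrib]
  refine Finset.sum_congr rfl fun i _ => ?_
  rw [map_smul, smul_apply, flat_antisymm ω (u i) v, smul_neg]

theorem wedge_one_form (a : V [⋀^Fin k]→L[ℝ] ℝ) (θ : V [⋀^Fin 1]→L[ℝ] ℝ) :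
    wedge a θ = (-1 : ℝ) ^ k • covectorWedge
      (ContinuousAlternatingMap.apply ℝ V ℝ ![] ∘L curryLeft θ) a := by
  have h : θ = alternatizeUncurryFin (curryLeft θ) := by
    rw [alternatizeUncurryFin_curryLeft]; simp
  conv_lhs => rw [h]
  rw [wedge_alternatizeUncurryFin, covectorWedge_apply]
  congr 2
  ext1 v
  exact wedge_degree_zero a _

end Fock

section Lefschetz

open ContinuousAlternatingMap (alternatizeUncurryFin alternatizeUncurryFinCLM_apply
  alternatizeUncurryFin_curryLeft curryLeft)

variable {m k l : ℕ}

local notation "𝔼" => (Fin m → ℝ)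

theorem flat_eq_sum (ω : 𝔼 [⋀^Fin 2]→L[ℝ] ℝ) (u : 𝔼) :
    flat ω u = ∑ j, u j • flat ω (Pi.single j 1) := by
  rw [← flat_sum]
  congr 1
  funext i
  simp [Finset.sum_apply, Pi.single_apply]

/-- In coordinates, `a ∧ ω = ½ ∑ⱼ dxʲ ∧ ω(eⱼ, ·) ∧ a`. -/
theorem wedge_two_form (a : 𝔼 [⋀^Fin k]→L[ℝ] ℝ) (ω : 𝔼 [⋀^Fin 2]→L[ℝ] ℝ) :
    wedge a ω = (1 / 2 : ℝ) • ∑ j, covectorWedge (ContinuousLinearMap.proj j)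
      (covectorWedge (flat ω (Pi.single j 1)) a) := by
  have h : (2 : ℝ) • ω = alternatizeUncurryFin (curryLeft ω) := by
    rw [alternatizeUncurryFin_curryLeft]; norm_cast
  have h1 : (2 : ℝ) • wedge a ω = ∑ j, covectorWedge (ContinuousLinearMap.proj j)
      (covectorWedge (flat ω (Pi.single j 1)) a) := by
    rw [← wedgeL_apply, ← map_smul, h, wedgeL_apply, wedge_alternatizeUncurryFin]
    simp only [covectorWedge_apply (ContinuousLinearMap.proj (R := ℝ) (φ := fun _ : Fin m => ℝ) _)]
    simp only [← alternatizeUncurryFinCLM_apply]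
    rw [← map_sum, ← map_smul]
    congr 1
    ext1 v
    have h2 : ∀ u, curryLeft ω u = interior u ω := fun _ => rfl
    simp only [smul_apply, ContinuousLinearMap.comp_apply, h2, wedgeL_apply,
      wedge_one_form, sum_apply, ContinuousLinearMap.smulRight_apply,
      ContinuousLinearMap.proj_apply]
    rw [smul_smul, ← mul_pow]
    simp only [mul_neg, mul_one, neg_neg, one_pow, one_smul]
    change covectorWedge (flat ω v) a = _
    rw [flat_eq_sum]
    simp
  rw [← h1, smul_smul]
  simp

/-- The case of associativity needed for powers of a 2-form. It follows from `wedge_two_form`, as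
wedging with `a` commutes with creation operators up to a sign which here occurs twice. -/
theorem wedge_wedge_two_form (a : 𝔼 [⋀^Fin k]→L[ℝ] ℝ) (b : 𝔼 [⋀^Fin l]→L[ℝ] ℝ)
    (ω : 𝔼 [⋀^Fin 2]→L[ℝ] ℝ) :
    wedge a (wedge b ω) = (wedge (wedge a b) ω : 𝔼 [⋀^Fin (k + l + 2)]→L[ℝ] ℝ) := by
  rw [wedge_two_form b, wedge_two_form (wedge a b), ← wedgeL_apply, map_smul, map_sum]
  congr 1
  refine Finset.sum_congr rfl fun j _ => ?_
  rw [wedgeL_apply, wedge_covectorWedge, wedge_covectorWedge, map_smul, smul_smul, ← mul_pow]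
  simp

/-- The Lefschetz operator `a ↦ a ∧ ω`, see `lefschetzOp_add_two`. -/
def lefschetzOp (ω : 𝔼 [⋀^Fin 2]→L[ℝ] ℝ) : GradedForms 𝔼 →ₗ[ℝ] GradedForms 𝔼 :=
  (1 / 2 : ℝ) • ∑ j, creation (ContinuousLinearMap.proj j) ∘ₗ creation (flat ω (Pi.single j 1))

theorem lefschetzOp_apply (ω : 𝔼 [⋀^Fin 2]→L[ℝ] ℝ) (a : GradedForms 𝔼) :
    lefschetzOp ω a = (1 / 2 : ℝ) • ∑ j, creation (ContinuousLinearMap.proj j)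
      (creation (flat ω (Pi.single j 1)) a) := by
  simp [lefschetzOp]

theorem lefschetzOp_zero (ω : 𝔼 [⋀^Fin 2]→L[ℝ] ℝ) (a : GradedForms 𝔼) :
    lefschetzOp ω a 0 = 0 := by
  simp [lefschetzOp_apply, creation_zero]

theorem lefschetzOp_one (ω : 𝔼 [⋀^Fin 2]→L[ℝ] ℝ) (a : GradedForms 𝔼) :
    lefschetzOp ω a 1 = 0 := by
  rw [lefschetzOp_apply, Pi.smul_apply, Finset.sum_apply,
    Finset.sum_eq_zero fun j _ => ?_, smul_zero]
  rw [creation_succ, creation_zero, map_zero]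

theorem lefschetzOp_add_two (ω : 𝔼 [⋀^Fin 2]→L[ℝ] ℝ) (a : GradedForms 𝔼) (k : ℕ) :
    lefschetzOp ω a (k + 2) = wedge (a k) ω := by
  rw [wedge_two_form, lefschetzOp_apply, Pi.smul_apply, Finset.sum_apply]
  rfl

theorem annihilation_lefschetzOp (ω : 𝔼 [⋀^Fin 2]→L[ℝ] ℝ) (u : 𝔼) (a : GradedForms 𝔼) :
    annihilation u (lefschetzOp ω a) =
      lefschetzOp ω (annihilation u a) + creation (flat ω u) a := by
  have h1 := flat_eq_sum ω u
  have h2 : -flat ω u = ∑ j, flat ω (Pi.single j 1) u • ContinuousLinearMap.proj (R := ℝ)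
      (φ := fun _ : Fin m => ℝ) j := by
    ext1 v
    have := congrArg (fun θ => θ u) (flat_eq_sum ω v)
    rw [neg_apply, ← flat_antisymm]
    simpa [mul_comm] using this
  rw [lefschetzOp_apply, lefschetzOp_apply, map_smul, map_sum]
  simp only [annihilation_creation, map_sub, map_smul, ContinuousLinearMap.proj_apply]
  simp only [Finset.sum_sub_distrib]
  have h1' := congrArg (fun θ => creation θ a) h1
  have h2' := congrArg (fun θ => creation θ a) h2
  simp only [map_sum, map_smul, LinearMap.sum_apply, LinearMap.smul_apply, map_neg,
    LinearMap.neg_apply] at h1' h2'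
  rw [← h1', ← h2']
  module

end Lefschetz

/-! ### Representations of `sl₂` -/

section SlTwo

variable {M : Type*} [AddCommGroup M] [Module ℝ M] {e f D : M →ₗ[ℝ] M} {c : ℝ}

theorem weight_pow (hDe : ∀ x, D (e x) = e (D x) + (2 : ℝ) • e x) {w : ℝ} {x : M}
    (hx : D x = w • x) (s : ℕ) : D ((e ^ s) x) = (w + 2 * s) • (e ^ s) x := by
  induction s with
  | zero => simp [hx]
  | succ s ih =>
    rw [pow_succ', Module.End.mul_apply, hDe, ih, map_smul]
    push_cast
    module

theorem lower_raise_pow (hfe : ∀ x, f (e x) = e (f x) + c • x - D x)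
    (hDe : ∀ x, D (e x) = e (D x) + (2 : ℝ) • e x) {w : ℝ} {x : M} (hx : D x = w • x) (s : ℕ) :
    f ((e ^ (s + 1)) x) =
      (e ^ (s + 1)) (f x) + ((s + 1) * (c - w - s)) • (e ^ s) x := by
  induction s with
  | zero =>
    simp [hfe, hx]
    module
  | succ s ih =>
    have h : ∀ j y, (e ^ (j + 1)) y = e ((e ^ j) y) := fun j y => by
      rw [pow_succ', Module.End.mul_apply]
    rw [h (s + 1), hfe, ih, weight_pow hDe hx (s + 1), map_add, map_smul, h (s + 1) (f x), ← h s]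
    push_cast
    module

/-- Let `e`, `f` and `c - D` generate a representation of `sl₂`. On vectors of weight `c - k`
on which `f` acts nilpotently, `eᵏ` is injective. The induction is over the order of nilpotency:
if `eᵏ x = 0`, then `f x` is killed by `eᵏ⁺²`, hence zero, and then `f` undoes `e` step by step. -/
theorem eq_zero_of_raise_pow_eq_zero (hfe : ∀ x, f (e x) = e (f x) + c • x - D x)
    (hDe : ∀ x, D (e x) = e (D x) + (2 : ℝ) • e x)
    (hDf : ∀ x, D (f x) = f (D x) - (2 : ℝ) • f x) {r k : ℕ} {x : M}
    (hx : D x = (c - k) • x) (hr : (f ^ r) x = 0) (hk : (e ^ k) x = 0) : x = 0 := by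
  induction r generalizing k x with
  | zero => simpa using hr
  | succ r ih =>
    have hk1 : (e ^ (k + 1)) x = 0 := by rw [pow_succ', Module.End.mul_apply, hk, map_zero]
    have hk2 : (e ^ (k + 2)) x = 0 := by rw [pow_succ', Module.End.mul_apply, hk1, map_zero]
    have hfx : f x = 0 := by
      refine ih (k := k + 2) ?_ (by rwa [pow_succ, Module.End.mul_apply] at hr) ?_
      · rw [hDf, hx, map_smul]
        push_cast
        module
      · have := lower_raise_pow hfe hDe hx (k + 1)
        rwa [hk1, hk2, map_zero, smul_zero, add_zero, eq_comm] at this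
    have descend : ∀ j ≤ k, (e ^ j) x = 0 → x = 0 := by
      intro j
      induction j with
      | zero => intro _ h; simpa using h
      | succ j ihj =>
        intro hj h
        refine ihj (by omega) ?_
        have := lower_raise_pow hfe hDe hx j
        rw [h, hfx, map_zero, map_zero, zero_add, eq_comm, smul_eq_zero] at this
        refine this.resolve_left (mul_ne_zero (by positivity) ?_)
        have : (j : ℝ) + 1 ≤ k := by exact_mod_cast hj
        linarith
    exact descend k le_rfl hk

end SlTwo

/-! ### The Hard Lefschetz theorem for a symplectic vector space -/

section LinearLefschetz

variable {m k l : ℕ}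

local notation "𝔼" => (Fin m → ℝ)

theorem degree_creation (θ : 𝔼 →L[ℝ] ℝ) (a : GradedForms 𝔼) :
    degree (creation θ a) = creation θ (degree a) + creation θ a := by
  funext k
  rw [Pi.add_apply, degree_apply]
  cases k with
  | zero => simp [creation_zero]
  | succ k =>
    rw [creation_succ, creation_succ, degree_apply, map_smul]
    push_cast
    module

theorem degree_annihilation (u : 𝔼) (a : GradedForms 𝔼) :
    degree (annihilation u a) = annihilation u (degree a) - annihilation u a := by
  funext k
  rw [Pi.sub_apply, degree_apply, annihilation_apply, annihilation_apply, degree_apply, map_smul]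
  push_cast
  module

theorem degree_lefschetzOp (ω : 𝔼 [⋀^Fin 2]→L[ℝ] ℝ) (a : GradedForms 𝔼) :
    degree (lefschetzOp ω a) = lefschetzOp ω (degree a) + (2 : ℝ) • lefschetzOp ω a := by
  simp only [lefschetzOp_apply, map_smul, map_sum, degree_creation, map_add,
    Finset.sum_add_distrib]
  module

/-- The operator `½ ∑ᵢ ι_{cᵢ} ι_{eᵢ}`. If `cᵢ` is the basis dual to the standard
basis with respect to a symplectic form, then this is the dual Lefschetz operator. -/
def dualLefschetzOp (c : Fin m → 𝔼) : GradedForms 𝔼 →ₗ[ℝ] GradedForms 𝔼 :=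
  (1 / 2 : ℝ) • ∑ i, annihilation (c i) ∘ₗ annihilation (Pi.single i 1)

theorem dualLefschetzOp_apply (c : Fin m → 𝔼) (a : GradedForms 𝔼) :
    dualLefschetzOp c a =
      (1 / 2 : ℝ) • ∑ i, annihilation (c i) (annihilation (Pi.single i 1) a) := by
  simp [dualLefschetzOp]

theorem degree_dualLefschetzOp (c : Fin m → 𝔼) (a : GradedForms 𝔼) :
    degree (dualLefschetzOp c a) =
      dualLefschetzOp c (degree a) - (2 : ℝ) • dualLefschetzOp c a := by
  simp only [dualLefschetzOp_apply, map_smul, map_sum, degree_annihilation, map_sub,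
    Finset.sum_sub_distrib]
  module

/-- A 2-form on a vector space is non-degenerate if its kernel is zero. -/
def Nondegenerate (ω : 𝔼 [⋀^Fin 2]→L[ℝ] ℝ) : Prop := ∀ u, flat ω u = 0 → u = 0

/-- The basis dual to the standard basis with respect to a non-degenerate form:
`ω(eⱼ, cᵢ) = δᵢⱼ`. -/
theorem Nondegenerate.exists_dual_basis {ω : 𝔼 [⋀^Fin 2]→L[ℝ] ℝ} (hω : Nondegenerate ω) :
    ∃ c : Fin m → 𝔼, ∀ i, flat ω (c i) = -ContinuousLinearMap.proj i := by
  let T : 𝔼 →ₗ[ℝ] 𝔼 := LinearMap.pi fun j => (flat ω (Pi.single j 1)).toLinearMap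
  have hT : Function.Injective T := by
    rw [← LinearMap.ker_eq_bot, LinearMap.ker_eq_bot']
    intro u hu
    refine hω u ?_
    ext1 v
    rw [flat_antisymm, flat_eq_sum ω v, sum_apply]
    have : ∀ j, flat ω (Pi.single j 1) u = 0 := fun j => congrFun hu j
    simp [this]
  obtain ⟨c, hc⟩ := (LinearMap.injective_iff_surjective.1 hT).hasRightInverse
  refine ⟨fun i => c (Pi.single i 1), fun i => ?_⟩
  ext1 v
  have h : ∀ j, flat ω (Pi.single j 1) (c (Pi.single i 1)) = (Pi.single i 1 : 𝔼) j :=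
    fun j => congrFun (hc (Pi.single i 1)) j
  rw [flat_antisymm, flat_eq_sum ω v, sum_apply]
  simp [h, Pi.single_apply]

/-- The commutator of the Lefschetz operator and its dual is `m / 2 - degree`. -/
theorem dualLefschetzOp_lefschetzOp {ω : 𝔼 [⋀^Fin 2]→L[ℝ] ℝ} (hω : Nondegenerate ω)
    {c : Fin m → 𝔼} (hc : ∀ i, flat ω (c i) = -ContinuousLinearMap.proj i) (a : GradedForms 𝔼) :
    dualLefschetzOp c (lefschetzOp ω a) =
      lefschetzOp ω (dualLefschetzOp c a) + ((m : ℝ) / 2) • a - degree a := by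
  have hcj : ∀ i j, flat ω (Pi.single j 1) (c i) = (Pi.single j 1 : 𝔼) i := fun i j => by
    rw [flat_antisymm, hc]
    simp
  have h1 : ∑ i, creation (ContinuousLinearMap.proj (R := ℝ) (φ := fun _ : Fin m => ℝ) i)
      (annihilation (Pi.single i 1) a) = degree a :=
    sum_creation_annihilation (fun v => by
      funext i; simp [Finset.sum_apply, Pi.single_apply]) a
  have h2 : ∑ i, creation (flat ω (Pi.single i 1)) (annihilation (c i) a) = degree a := by
    refine sum_creation_annihilation (fun v => ?_) a
    rw [← sub_eq_zero]
    refine hω _ ?_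
    have : flat ω (∑ i, flat ω (Pi.single i 1) v • c i) = flat ω v := by
      rw [flat_sum]
      ext1 w
      rw [flat_antisymm ω v w, flat_eq_sum ω w]
      simp [hc, mul_comm]
    ext1 w
    have h := congrArg (fun θ => θ w) this
    rw [flat_antisymm ω _ w, flat_antisymm ω v w] at h
    rw [flat_antisymm, map_sub, zero_apply]
    linarith
  have h3 : ∀ i, annihilation (c i) (annihilation (Pi.single i 1) (lefschetzOp ω a)) =
      lefschetzOp ω (annihilation (c i) (annihilation (Pi.single i 1) a)) + a
      - creation (ContinuousLinearMap.proj i) (annihilation (Pi.single i 1) a)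
      - creation (flat ω (Pi.single i 1)) (annihilation (c i) a) := fun i => by
    rw [annihilation_lefschetzOp, map_add, annihilation_lefschetzOp, annihilation_creation, hcj,
      hc]
    simp
    abel
  rw [dualLefschetzOp_apply, dualLefschetzOp_apply]
  simp only [h3, Finset.sum_sub_distrib, Finset.sum_add_distrib, h1, h2, map_smul, map_sum]
  simp only [Finset.sum_const, Finset.card_univ, Fintype.card_fin, ← Nat.cast_smul_eq_nsmul ℝ]
  module

theorem dualLefschetzOp_pow_eq_zero (c : Fin m → 𝔼) (N : ℕ) {a : GradedForms 𝔼}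
    (ha : ∀ k, N ≤ k → a k = 0) : (dualLefschetzOp c ^ N) a = 0 := by
  induction N generalizing a with
  | zero => funext k; simpa using ha k (Nat.zero_le k)
  | succ N ih =>
    rw [pow_succ, Module.End.mul_apply]
    refine ih fun k hk => ?_
    rw [dualLefschetzOp_apply, Pi.smul_apply, Finset.sum_apply]
    simp [annihilation_apply, ha (k + 1 + 1) (by omega)]

theorem eq_zero_of_lt_degree (a : 𝔼 [⋀^Fin k]→L[ℝ] ℝ) (h : m < k) : a = 0 := by
  ext v
  refine a.toAlternatingMap.map_linearDependent v fun hv => ?_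
  have := hv.fintype_card_le_finrank
  simp at this
  omega

theorem lefschetzOp_pow_apply_eq_zero (ω : 𝔼 [⋀^Fin 2]→L[ℝ] ℝ) (N : ℕ) (a : GradedForms 𝔼) {k : ℕ}
    (hk : k < N) : (lefschetzOp ω ^ N) a k = 0 := by
  induction N generalizing k with
  | zero => omega
  | succ N ih =>
    rw [pow_succ', Module.End.mul_apply]
    match k with
    | 0 => exact lefschetzOp_zero _ _
    | 1 => exact lefschetzOp_one _ _
    | k + 2 =>
      rw [lefschetzOp_add_two, ih (by omega), ← wedgeL_apply]
      simp

theorem lefschetzOp_pow_eq_zero (ω : 𝔼 [⋀^Fin 2]→L[ℝ] ℝ) (a : GradedForms 𝔼) :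
    (lefschetzOp ω ^ (m + 1)) a = 0 := by
  funext k
  by_cases hk : k < m + 1
  · exact lefschetzOp_pow_apply_eq_zero ω _ a hk
  · exact eq_zero_of_lt_degree _ (by omega)

theorem apply_eq_zero_of_degree_eq {a : GradedForms 𝔼} {p : ℝ} (h : degree a = p • a) {k : ℕ}
    (hk : (k : ℝ) ≠ p) : a k = 0 := by
  have : ((k : ℝ) - p) • a k = 0 :=
    (sub_smul (k : ℝ) p (a k)).trans (sub_eq_zero.2 (congrFun h k))
  exact (smul_eq_zero.1 this).resolve_left (sub_ne_zero.2 hk)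

theorem degree_single (p : ℕ) (a : 𝔼 [⋀^Fin p]→L[ℝ] ℝ) :
    degree (Pi.single p a : GradedForms 𝔼) = (p : ℝ) • Pi.single p a := by
  funext k
  rw [degree_apply, Pi.smul_apply]
  by_cases h : k = p
  · subst h; rfl
  · simp [h]

/-- The power `ωᵏ` of an alternating 2-form. -/
def altPow (ω : 𝔼 [⋀^Fin 2]→L[ℝ] ℝ) : (k : ℕ) → 𝔼 [⋀^Fin (2 * k)]→L[ℝ] ℝ
  | 0 => ContinuousAlternatingMap.constOfIsEmpty ℝ 𝔼 (Fin 0) 1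
  | k + 1 => wedge (altPow ω k) ω

theorem lefschetzOp_pow_apply (ω : 𝔼 [⋀^Fin 2]→L[ℝ] ℝ) (a : GradedForms 𝔼) (p k : ℕ) :
    (lefschetzOp ω ^ k) a (p + 2 * k) = wedge (a p) (altPow ω k) := by
  induction k with
  | zero =>
    change a p = wedge (a p) (ContinuousAlternatingMap.constOfIsEmpty ℝ 𝔼 (Fin 0) 1)
    rw [wedge_degree_zero]
    simp
  | succ k ih =>
    rw [pow_succ', Module.End.mul_apply]
    change lefschetzOp ω _ (p + 2 * k + 2) = wedge (a p) (wedge (altPow ω k) ω)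
    rw [lefschetzOp_add_two, ih, wedge_wedge_two_form]

instance finiteDimensional_alternating :
    FiniteDimensional ℝ (𝔼 [⋀^Fin k]→L[ℝ] ℝ) := by
  refine Module.Finite.of_injective
    (⟨⟨fun a => a.toMultilinearMap, fun _ _ => rfl⟩, fun _ _ => rfl⟩ :
      (𝔼 [⋀^Fin k]→L[ℝ] ℝ) →ₗ[ℝ] MultilinearMap ℝ (fun _ : Fin k => 𝔼) ℝ) fun a b h => ?_
  ext v
  exact congrArg (fun f => f v) h

/-- The Hard Lefschetz theorem for a symplectic vector space. -/
theorem bijective_wedge_altPow {n : ℕ} (hm : m = 2 * n) {ω : 𝔼 [⋀^Fin 2]→L[ℝ] ℝ}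
    (hω : Nondegenerate ω) {p : ℕ} (hp : p + k = n) :
    Function.Bijective fun a : 𝔼 [⋀^Fin p]→L[ℝ] ℝ => wedge a (altPow ω k) := by
  obtain ⟨c, hc⟩ := hω.exists_dual_basis
  have hcomm : ∀ a, dualLefschetzOp c (lefschetzOp ω a) =
      lefschetzOp ω (dualLefschetzOp c a) + (n : ℝ) • a - degree a := fun a => by
    have h : (m : ℝ) / 2 = n := by
      rw [hm]
      push_cast
      ring
    rw [dualLefschetzOp_lefschetzOp hω hc a, h]
  have hn : (n : ℝ) = p + k := by exact_mod_cast hp.symm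
  let A : (𝔼 [⋀^Fin p]→L[ℝ] ℝ) →ₗ[ℝ] 𝔼 [⋀^Fin (p + 2 * k)]→L[ℝ] ℝ :=
    LinearMap.proj (p + 2 * k) ∘ₗ (lefschetzOp ω ^ k) ∘ₗ
      LinearMap.single ℝ (fun j => 𝔼 [⋀^Fin j]→L[ℝ] ℝ) p
  let B : (𝔼 [⋀^Fin (p + 2 * k)]→L[ℝ] ℝ) →ₗ[ℝ] 𝔼 [⋀^Fin p]→L[ℝ] ℝ :=
    LinearMap.proj p ∘ₗ (dualLefschetzOp c ^ k) ∘ₗ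
      LinearMap.single ℝ (fun j => 𝔼 [⋀^Fin j]→L[ℝ] ℝ) (p + 2 * k)
  have hA : Function.Injective A := by
    rw [← LinearMap.ker_eq_bot, LinearMap.ker_eq_bot']
    intro a ha
    rw [← Pi.single_eq_zero_iff (i := p) (M := fun p => 𝔼 [⋀^Fin p]→L[ℝ] ℝ)]
    refine eq_zero_of_raise_pow_eq_zero (k := k) hcomm (degree_lefschetzOp ω)
      (degree_dualLefschetzOp c) ?_
      (dualLefschetzOp_pow_eq_zero c (p + 1) fun j hj =>
        Pi.single_eq_of_ne (M := fun j => 𝔼 [⋀^Fin j]→L[ℝ] ℝ) (by omega : j ≠ p) a) ?_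
    · rw [degree_single, hn]
      congr 1
      ring
    · funext j
      by_cases hj : j = p + 2 * k
      · subst hj
        exact ha
      · refine apply_eq_zero_of_degree_eq (p := p + 2 * k)
          (weight_pow (degree_lefschetzOp ω) (degree_single p a) k) ?_
        exact_mod_cast hj
  -- The dual operator raises the reversed degree `2n - degree`, so the same lemma applies.
  have hB : Function.Injective B := by
    rw [← LinearMap.ker_eq_bot, LinearMap.ker_eq_bot']
    intro a ha
    rw [← Pi.single_eq_zero_iff (i := p + 2 * k) (M := fun p => 𝔼 [⋀^Fin p]→L[ℝ] ℝ)]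
    let D : GradedForms 𝔼 →ₗ[ℝ] GradedForms 𝔼 := (2 * n : ℝ) • LinearMap.id - degree
    have hD : ∀ x, D x = (2 * n : ℝ) • x - degree x := fun _ => rfl
    have hDf : ∀ x, D (dualLefschetzOp c x) =
        dualLefschetzOp c (D x) + (2 : ℝ) • dualLefschetzOp c x := fun x => by
      rw [hD, hD, degree_dualLefschetzOp, map_sub, map_smul]
      abel
    have hw : D (Pi.single (p + 2 * k) a) =
        ((n : ℝ) - k) • (Pi.single (p + 2 * k) a : GradedForms 𝔼) := by
      rw [hD, degree_single, hn]
      push_cast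
      module
    refine eq_zero_of_raise_pow_eq_zero (k := k) (e := dualLefschetzOp c) (f := lefschetzOp ω)
      (D := D) (c := n) (fun x => ?_) hDf (fun x => ?_) hw (lefschetzOp_pow_eq_zero ω _) ?_
    · rw [hcomm, hD]
      module
    · rw [hD, hD, degree_lefschetzOp, map_sub, map_smul]
      abel
    · funext j
      by_cases hj : j = p
      · subst hj
        exact ha
      · have h := weight_pow hDf hw k
        rw [hD] at h
        refine apply_eq_zero_of_degree_eq (p := p) ?_ (by exact_mod_cast hj)
        rw [← sub_sub_self ((2 * n : ℝ) • (dualLefschetzOp c ^ k) (Pi.single (p + 2 * k) a))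
          (degree _), h, hn]
        module
  have hd : Module.finrank ℝ (𝔼 [⋀^Fin p]→L[ℝ] ℝ) =
      Module.finrank ℝ (𝔼 [⋀^Fin (p + 2 * k)]→L[ℝ] ℝ) :=
    le_antisymm (LinearMap.finrank_le_finrank_of_injective hA)
      (LinearMap.finrank_le_finrank_of_injective hB)
  have hAw : (A : (𝔼 [⋀^Fin p]→L[ℝ] ℝ) → _) = fun a => wedge a (altPow ω k) := funext fun a => by
    change (lefschetzOp ω ^ k) (Pi.single p a) (p + 2 * k) = _
    rw [lefschetzOp_pow_apply, Pi.single_eq_same]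
  rw [← hAw]
  exact ⟨hA, (LinearMap.injective_iff_surjective_of_finrank_eq_finrank hd).1 hA⟩

/-- The top power of a symplectic form is a volume form. -/
theorem Nondegenerate.altPow_ne_zero {n : ℕ} (hm : m = 2 * n) {ω : 𝔼 [⋀^Fin 2]→L[ℝ] ℝ}
    (hω : Nondegenerate ω) : altPow ω n ≠ 0 := by
  intro h
  have h1 := (bijective_wedge_altPow hm hω (zero_add n)).1
    (a₁ := ContinuousAlternatingMap.constOfIsEmpty ℝ 𝔼 (Fin 0) 1) (a₂ := 0) (by
      simp only [h, ← wedgeL_apply, map_zero])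
  have := congrArg (fun f => f ![]) h1
  simp at this

/-- If `ω(u, ·) = 0`, then `ι_u` commutes with the Lefschetz operator, and so `ι_u ωⁿ = 0`. -/
theorem nondegenerate_of_altPow_ne_zero {n : ℕ} (hm : m = 2 * n) {ω : 𝔼 [⋀^Fin 2]→L[ℝ] ℝ}
    (h : altPow ω n ≠ 0) : Nondegenerate ω := by
  intro u hu
  by_contra hne
  obtain ⟨i, hi⟩ : ∃ i, u i ≠ 0 := by
    by_contra! h0
    exact hne (funext h0)
  -- The unit, whose image under the Lefschetz operator is `ωⁿ`.
  let x : GradedForms 𝔼 :=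
    Pi.single 0 (ContinuousAlternatingMap.constOfIsEmpty ℝ 𝔼 (Fin 0) 1)
  have h1 : ∀ s, annihilation u ((lefschetzOp ω ^ s) x) = 0 := by
    intro s
    induction s with
    | zero =>
      funext k
      have hx : x (k + 1) = 0 := Pi.single_eq_of_ne (Nat.succ_ne_zero k) _
      rw [pow_zero, Module.End.one_apply, annihilation_apply, hx, map_zero]
      rfl
    | succ s ih =>
      rw [pow_succ', Module.End.mul_apply, annihilation_lefschetzOp, ih, hu]
      simp
  have h2 : ∀ s, (lefschetzOp ω ^ s) x (2 * s) = altPow ω s := by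
    intro s
    induction s with
    | zero => 
      change x 0 = ContinuousAlternatingMap.constOfIsEmpty ℝ 𝔼 (Fin 0) 1
      simp [x]
    | succ s ih =>
      rw [pow_succ', Module.End.mul_apply]
      change lefschetzOp ω _ (2 * s + 2) = wedge (altPow ω s) ω
      rw [lefschetzOp_add_two, ih]
  -- Contracting `dxⁱ ∧ ωⁿ = 0` with `u` gives `uᵢ ωⁿ = 0`.
  have h3 := congrFun (annihilation_creation u (ContinuousLinearMap.proj i)
    ((lefschetzOp ω ^ n) x)) (2 * n)
  rw [h1, map_zero, sub_zero, annihilation_apply, eq_zero_of_lt_degree (creation _ _ _) (by omega),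
    map_zero, Pi.smul_apply, h2, eq_comm, smul_eq_zero] at h3
  exact h3.elim hi h

end LinearLefschetz

/-! ### Compatible complex structures on a symplectic vector space -/

section Darboux

/-- A linear Darboux theorem: a symplectic vector space is isomorphic to some `ℂⁿ` with the
imaginary part of the standard Hermitian form. One splits off a hyperbolic plane, viewed as a
copy of `ℂ`, and continues with its symplectic complement. -/
theorem exists_complex_coordinates (V : Type) [AddCommGroup V] [Module ℝ V]
    [FiniteDimensional ℝ V] (B : V →ₗ[ℝ] V →ₗ[ℝ] ℝ) (halt : B.IsAlt)
    (hB : ∀ u, B u = 0 → u = 0) :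
    ∃ (n : ℕ) (φ : V ≃ₗ[ℝ] (Fin n → ℂ)),
      ∀ x y, B x y = ∑ i, (starRingEnd ℂ (φ x i) * φ y i).im := by
  induction hN : Module.finrank ℝ V using Nat.strong_induction_on generalizing V with
  | _ N ih =>
  subst hN
  rcases subsingleton_or_nontrivial V with hV | hV
  · refine ⟨0, LinearEquiv.ofSubsingleton _ _, fun x y => ?_⟩
    simp [Subsingleton.elim x 0]
  obtain ⟨u, hu⟩ := exists_ne (0 : V)
  obtain ⟨v', hv'⟩ : ∃ v, B u v ≠ 0 := by
    by_contra! h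
    exact hu (hB u (LinearMap.ext h))
  obtain ⟨v, huv⟩ : ∃ v, B u v = 1 := ⟨(B u v')⁻¹ • v', by simp [hv']⟩
  have hanti : ∀ x y, B x y = -B y x := fun x y => (halt.neg y x).symm
  let W : Submodule ℝ V := LinearMap.ker (B u) ⊓ LinearMap.ker (B v)
  have hWu : ∀ w : W, B u w = 0 := fun w => w.2.1
  have hWv : ∀ w : W, B v w = 0 := fun w => w.2.2
  have hWu' : ∀ w : W, B w u = 0 := fun w => by rw [hanti, hWu, neg_zero]
  have hWv' : ∀ w : W, B w v = 0 := fun w => by rw [hanti, hWv, neg_zero]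
  have hvu : B v u = -1 := by rw [hanti, huv]
  -- The splitting of `V` into the plane spanned by `u` and `v` and its symplectic complement.
  let e : V ≃ₗ[ℝ] ℂ × W :=
    { toFun := fun x => (⟨B x v, B u x⟩, ⟨x - B x v • u - B u x • v, by
        constructor
        · simp [halt u, huv]
        · simp [halt v, hvu, hanti v x]⟩)
      map_add' := fun x y => by
        refine Prod.ext (Complex.ext ?_ ?_) (Subtype.ext ?_)
        · simp
        · simp
        · simp only [map_add, LinearMap.add_apply, Prod.snd_add, Submodule.coe_add]
          module
      map_smul' := fun c x => by
        refine Prod.ext (Complex.ext ?_ ?_) (Subtype.ext ?_)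
        · simp
        · simp
        · simp only [map_smul, LinearMap.smul_apply, Prod.smul_snd, Submodule.coe_smul,
            RingHom.id_apply, smul_eq_mul]
          module
      invFun := fun p => p.1.re • u + p.1.im • v + p.2
      left_inv := fun x => by
        simp only
        module
      right_inv := fun p => by
        have h1 : B (p.1.re • u + p.1.im • v + p.2) v = p.1.re := by
          simp [halt v, huv, hWv']
        have h2 : B u (p.1.re • u + p.1.im • v + p.2) = p.1.im := by
          simp [halt u, huv, hWu]
        refine Prod.ext (Complex.ext h1 h2) (Subtype.ext ?_)
        simp only [h1, h2]
        module }
  have he : ∀ p q : ℂ × W, B (e.symm p) (e.symm q) =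
      (starRingEnd ℂ p.1 * q.1).im + B p.2 q.2 := fun p q => by
    change B (p.1.re • u + p.1.im • v + p.2) (q.1.re • u + q.1.im • v + q.2) = _
    simp [halt u, halt v, huv, hvu, hWu, hWv, hWu', hWv']
  have hlt : Module.finrank ℝ W < Module.finrank ℝ V := by
    refine Submodule.finrank_lt fun h => ?_
    have := hWv ⟨u, h ▸ Submodule.mem_top⟩
    rw [hvu] at this
    norm_num at this
  obtain ⟨n, ψ, hψ⟩ := ih _ hlt W (B.compl₁₂ W.subtype W.subtype) (fun w => halt w)
    (fun w hw => by
      refine Subtype.ext (hB w (LinearMap.ext fun x => ?_))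
      have h := he (0, w) (e x)
      rw [LinearEquiv.symm_apply_apply] at h
      have h0 : e.symm (0, w) = w := by
        change (0 : ℂ).re • u + (0 : ℂ).im • v + (w : V) = w
        simp
      rw [h0] at h
      rw [h]
      simpa using congrArg (fun g => g (e x).2) hw) rfl
  refine ⟨n + 1, e ≪≫ₗ LinearEquiv.prodCongr (.refl ℝ ℂ) ψ ≪≫ₗ
    Fin.consLinearEquiv ℝ (fun _ => ℂ), fun x y => ?_⟩
  have h := he (e x) (e y)
  rw [LinearEquiv.symm_apply_apply, LinearEquiv.symm_apply_apply] at h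
  rw [h, Fin.sum_univ_succ]
  congr 1
  exact hψ (e x).2 (e y).2

/-- A non-degenerate form with constant coefficients is Kähler: multiplication by `i` in linear
Darboux coordinates is a compatible complex structure, and these coordinates are holomorphic. -/
theorem isKahler_constForm {n : ℕ} (ω₀ : closedForms (2 * n) 2)
    {c : (Fin (2 * n) → ℝ) [⋀^Fin 2]→L[ℝ] ℝ} (hω₀ : ω₀.1 = constForm c)
    (hc : Nondegenerate c) : IsKahler ω₀ := by
  have hval : ∀ t u v, ω₀.1.1 t ![u, v] = flat c u v := fun t u v => by rw [hω₀]; rfl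
  let B : (Fin (2 * n) → ℝ) →ₗ[ℝ] (Fin (2 * n) → ℝ) →ₗ[ℝ] ℝ :=
    LinearMap.mk₂ ℝ (fun u v => flat c u v)
      (fun u u' v => by rw [flat_antisymm, flat_antisymm c u, flat_antisymm c u', map_add]; ring)
      (fun a u v => by rw [flat_antisymm, flat_antisymm c u, map_smul, smul_neg])
      (fun u v v' => map_add _ _ _) (fun a u v => map_smul _ _ _)
  obtain ⟨n', φ, hφ⟩ := exists_complex_coordinates _ B
    (fun u => by have := flat_antisymm c u u; change flat c u u = 0; linarith)
    (fun u hu => hc u (ContinuousLinearMap.ext fun v => congrArg (fun g => g v) hu))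
  obtain rfl : n' = n := by
    have := φ.finrank_eq
    simp [Module.finrank_pi_fintype] at this
    omega
  have hφ' : ∀ u v, flat c u v = ∑ i, (starRingEnd ℂ (φ u i) * φ v i).im := hφ
  let Φ := φ.toContinuousLinearEquiv
  let J₀ : (Fin (2 * n') → ℝ) →L[ℝ] (Fin (2 * n') → ℝ) := LinearMap.toContinuousLinearMap
    (φ.symm.toLinearMap ∘ₗ Algebra.lsmul ℝ ℝ (Fin n' → ℂ) Complex.I ∘ₗ φ.toLinearMap)
  have hJ : ∀ v, φ (J₀ v) = Complex.I • φ v := fun v => φ.apply_symm_apply _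
  let J : AlmostComplex (2 * n') :=
    { J := fun _ => J₀
      smooth := contDiff_const
      sq := fun _ v => φ.injective (by
        rw [hJ, hJ, smul_smul, Complex.I_mul_I, map_neg, neg_one_smul]) }
  refine ⟨fun t u hu => hc u (ContinuousLinearMap.ext fun v => (hval t u v).symm.trans (hu v)),
    J, fun x => ?_, fun t u v => ?_, fun t w hw => ?_⟩
  · refine ⟨Φ.toHomeomorph.toOpenPartialHomeomorph, Set.mem_univ _, Φ.contDiff.contDiffOn,
      Φ.symm.contDiff.contDiffOn, fun y _ v => ?_⟩
    have : fderiv ℝ (Φ.toHomeomorph.toOpenPartialHomeomorph) y = Φ := Φ.fderiv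
    rw [this]
    exact hJ v
  · rw [hval, hval, hφ', hφ']
    refine Finset.sum_congr rfl fun i _ => ?_
    change (starRingEnd ℂ (φ (J₀ u) i) * φ (J₀ v) i).im = _
    rw [hJ, hJ]
    simp
  · rw [hval, hφ']
    have h1 : ∀ i, (starRingEnd ℂ (φ w i) * φ (J.J t w) i).im = Complex.normSq (φ w i) :=
      fun i => by
        change (starRingEnd ℂ (φ w i) * φ (J₀ w) i).im = _
        rw [hJ]
        simp [Complex.normSq_apply]
    simp only [h1]
    obtain ⟨i, hi⟩ : ∃ i, φ w i ≠ 0 := by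
      by_contra! h
      exact hw (φ.map_eq_zero_iff.1 (funext h))
    exact Finset.sum_pos' (fun i _ => Complex.normSq_nonneg _)
      ⟨i, Finset.mem_univ i, Complex.normSq_pos.2 hi⟩

end Darboux

/-! ### The Lefschetz map in terms of constant forms -/

section Torus

variable {m k l : ℕ}

theorem wedgeForm_sub_left (α α' : Form m k) (β : Form m l) :
    wedgeForm (α - α') β = wedgeForm α β - wedgeForm α' β :=
  lift_injective fun x => wedgeL.map_sub₂ (lift α x) (lift α' x) (lift β x)

theorem wedgeForm_sub_right (α : Form m k) (β β' : Form m l) :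
    wedgeForm α (β - β') = wedgeForm α β - wedgeForm α β' :=
  lift_injective fun x => (wedgeL (lift α x)).map_sub (lift β x) (lift β' x)

theorem wedgeForm_exact_right {α : Form m k} {β : Form m l} (hα : d α = 0)
    (hβ : β ∈ exactForms m l) : wedgeForm α β ∈ exactForms m (k + l) := by
  have h0 : ∀ j x, lift (0 : Form m j) x = 0 := fun _ _ => rfl
  cases l with
  | zero =>
    have : wedgeForm α β = 0 := lift_injective fun x => by
      rw [lift_wedgeForm, show β = 0 from hβ, h0, h0, ← wedgeL_apply, map_zero]
    rw [this]
    exact Submodule.zero_mem _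
  | succ l =>
    obtain ⟨η, rfl⟩ := hβ
    refine mem_exactForms_of_cast (r := k + l) rfl _ ((-1 : ℝ) ^ k • wedgeForm α η) fun x v => ?_
    have h1 : lift (d ((-1 : ℝ) ^ k • wedgeForm α η)) x v =
        (-1 : ℝ) ^ k * lift (d (wedgeForm α η)) x v := by
      rw [map_smul]
      rfl
    have h2 : lift (wedgeForm (d α) η) x = 0 := by
      rw [lift_wedgeForm, hα, h0, ← wedgeL_apply, map_zero, zero_apply]
    rw [h1, lift_d_wedgeForm, h2, ContinuousAlternatingMap.coe_zero, Pi.zero_apply, zero_add,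
      ← mul_assoc, ← mul_pow]
    simp

theorem wedgePow_sub_mem_exactForms {ω ω₀ : Form m 2} (hω : d ω = 0) (hω₀ : d ω₀ = 0)
    (h : ω - ω₀ ∈ exactForms m 2) (k : ℕ) :
    wedgePow ω k - wedgePow ω₀ k ∈ exactForms m (2 * k) := by
  induction k with
  | zero =>
    have : wedgePow ω 0 - wedgePow ω₀ 0 = 0 := sub_self (wedgePow ω 0)
    rw [this]
    exact Submodule.zero_mem _
  | succ k ih =>
    have := Submodule.add_mem _ (wedgeForm_exact ih hω)
      (wedgeForm_exact_right (d_wedgePow hω₀ k) h)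
    rwa [wedgeForm_sub_left, wedgeForm_sub_right, sub_add_sub_cancel] at this

theorem lift_wedgePow (ω : Form m 2) (k : ℕ) (x : Fin m → ℝ) :
    lift (wedgePow ω k) x = altPow (lift ω x) k := by
  induction k with
  | zero => rfl
  | succ k ih => rw [wedgePow, altPow, lift_wedgeForm, ih]

theorem deRhamClass_eq_iff (α β : closedForms m k) :
    deRhamClass α = deRhamClass β ↔ α.1 - β.1 ∈ exactForms m k :=
  Submodule.Quotient.eq _

/-- The class of the form with constant coefficients `c`. -/
def constClass (c : (Fin m → ℝ) [⋀^Fin k]→L[ℝ] ℝ) : DeRham m k :=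
  deRhamClass ⟨constForm c, d_constForm c⟩

/-- The cohomology of the torus is the exterior algebra of the constant forms. -/
theorem bijective_constClass : Function.Bijective (constClass (m := m) (k := k)) := by
  constructor
  · intro a b h
    rw [constClass, constClass, deRhamClass_eq_iff] at h
    exact sub_eq_zero.1 (eq_zero_of_constForm_mem_exactForms h)
  · intro x
    obtain ⟨α, rfl⟩ := Submodule.mkQ_surjective _ x
    obtain ⟨c, hc⟩ := exists_sub_constForm_mem_exactForms (show d α.1 = 0 from α.2)
    exact ⟨c, ((deRhamClass_eq_iff _ _).2 hc).symm⟩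

theorem lefschetz_constClass (ω : closedForms m 2) {c : (Fin m → ℝ) [⋀^Fin 2]→L[ℝ] ℝ}
    (h : ω.1 - constForm c ∈ exactForms m 2) (k p : ℕ) (a : (Fin m → ℝ) [⋀^Fin p]→L[ℝ] ℝ) :
    lefschetz ω k p (constClass a) = constClass (wedge a (altPow c k)) := by
  rw [constClass, lefschetz_deRhamClass, constClass, deRhamClass_eq_iff]
  have h1 : constForm (wedge a (altPow c k)) =
      wedgeForm (constForm a) (wedgePow (constForm c) k) := lift_injective fun x => by
    rw [lift_wedgeForm, lift_wedgePow]
    rfl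
  change wedgeForm (constForm a) (wedgePow ω.1 k) - constForm (wedge a (altPow c k)) ∈ _
  rw [h1, ← wedgeForm_sub_right]
  exact wedgeForm_exact_right (d_constForm a)
    (wedgePow_sub_mem_exactForms ω.2 (d_constForm c) h k)

/-- A form of top degree is determined by its value on the standard basis. -/
theorem apply_single_ne_zero {a : (Fin m → ℝ) [⋀^Fin m]→L[ℝ] ℝ} (ha : a ≠ 0) :
    a (fun i => Pi.single i 1) ≠ 0 := by
  intro h
  refine ha (ContinuousAlternatingMap.ext fun v => ?_)
  have h1 := congrArg (fun f => f v)
    (AlternatingMap.eq_smul_basis_det (Pi.basisFun ℝ (Fin m)) a.toAlternatingMap)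
  have h2 : a.toAlternatingMap (Pi.basisFun ℝ (Fin m)) = 0 := by
    rw [← h]
    exact congrArg a (funext fun i => Pi.basisFun_apply ℝ (Fin m) i)
  rw [h2, zero_smul] at h1
  exact h1

/-- The constant form cohomologous to a symplectic form `ω` is non-degenerate: otherwise its top
power vanishes, so `ωⁿ` is exact and averages to zero over the torus; but `ωⁿ` is a volume form,
whose coefficient has a constant sign. -/
theorem nondegenerate_of_isSymplectic {n : ℕ} {ω : closedForms (2 * n) 2} (hω : IsSymplectic ω)
    {c : (Fin (2 * n) → ℝ) [⋀^Fin 2]→L[ℝ] ℝ}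
    (h : ω.1 - constForm c ∈ exactForms (2 * n) 2) : Nondegenerate c := by
  refine nondegenerate_of_altPow_ne_zero rfl (n := n) fun hc => ?_
  have h0 : wedgePow (constForm c) n = 0 := lift_injective fun x => by
    rw [lift_wedgePow, lift_constForm, hc]
    rfl
  have hex := wedgePow_sub_mem_exactForms ω.2 (d_constForm c) h n
  rw [h0, sub_zero] at hex
  let g : (Fin (2 * n) → ℝ) → ℝ := fun x => lift (wedgePow ω.1 n) x fun i => Pi.single i 1
  have hg : ∀ x, g x ≠ 0 := fun x => by
    refine apply_single_ne_zero ?_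
    rw [lift_wedgePow]
    refine Nondegenerate.altPow_ne_zero rfl fun u hu => hω (proj x) u fun v => ?_
    exact congrArg (fun θ => θ v) hu
  have hgc : Continuous g := (ContinuousAlternatingMap.apply ℝ (Fin (2 * n) → ℝ) ℝ
    fun i => Pi.single i 1).continuous.comp (lift_differentiable (wedgePow ω.1 n)).continuous
  have hpos : ∀ x, 0 < g 0 * g x := by
    intro x
    by_contra! hx
    obtain ⟨y, hy⟩ := mem_range_of_exists_le_of_exists_ge (continuous_const.mul hgc) ⟨x, hx⟩
      ⟨0, (mul_self_pos.2 (hg 0)).le⟩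
    exact mul_ne_zero (hg 0) (hg y) hy
  have := lift_average_pos (List.finRange (2 * n)) (g 0) (fun i => Pi.single i 1) hpos 0
  rw [average_finRange_eq_zero_of_exact hex] at this
  exact this.ne' (mul_zero _)

end Torus

end TorusHLC

end

theorem mainTheorem4 (n : ℕ) (ω : TorusHLC.closedForms (2 * n) 2)
    (hω : TorusHLC.IsSymplectic ω) :
    (∃ ω₀ : TorusHLC.closedForms (2 * n) 2,
      TorusHLC.IsConstantCoefficient ω₀.1 ∧
      TorusHLC.deRhamClass ω = TorusHLC.deRhamClass ω₀ ∧
      TorusHLC.IsKahler ω₀) ∧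
    TorusHLC.HardLefschetz n ω := by
  obtain ⟨c, hc⟩ :=
    TorusHLC.exists_sub_constForm_mem_exactForms (show TorusHLC.d ω.1 = 0 from ω.2)
  have hnd := TorusHLC.nondegenerate_of_isSymplectic hω hc
  refine ⟨⟨⟨TorusHLC.constForm c, TorusHLC.d_constForm c⟩, ⟨c, fun _ => rfl⟩,
    (TorusHLC.deRhamClass_eq_iff _ _).2 hc, TorusHLC.isKahler_constForm _ rfl hnd⟩,
    fun k p hp => ?_⟩
  have h : TorusHLC.lefschetz ω k p ∘ TorusHLC.constClass =
      TorusHLC.constClass ∘ fun a => TorusHLC.wedge a (TorusHLC.altPow c k) :=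
    funext (TorusHLC.lefschetz_constClass ω hc k p)
  rw [← Function.Bijective.of_comp_iff _ TorusHLC.bijective_constClass, h]
  exact TorusHLC.bijective_constClass.comp (TorusHLC.bijective_wedge_altPow rfl hnd hp)
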